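/- Let $k$ be any field and let $L_1,\dots,L_r$ be finite cyclic Galois extensions of $k$ ($r\ge 0$), with Galois groups $G_i=\mathrm{Gal}(L_i/k)$ and 2-cocycles $\alpha_i\in Z^2(G_i,L_i^{*})$. Let $(L_i/k,G_i,\alpha_i)$ be the corresponding cyclic algebra, i.e. the crossed product with $L_i$-basis $\{U_\sigma\}_{\sigma\in G_i}$ and multiplication $(xU_\sigma)(yU_\tau)=x\,\sigma(y)\,\alpha_i(\sigma,\tau)\,U_{\sigma\tau}$ for $x,y\in L_i$, $\sigma,\tau\in G_i$. Let $C$ be a $k$-central simple algebra which is isomorphic, as a $k$-algebra, to $(L_1/k,G_1,\alpha_1)\otimes_k\cdots\otimes_k(L_r/k,G_r,\alpha_r)$. Then there are a finite dimensional Hopf algebra $H$ over $k$ and a surjective homomorphism of $k$-algebras $H\to C$; moreover, if the characteristic of $k$ divides none of the orders $|G_1|,\dots,|G_r|$ (in particular if it is $0$), then $H$ is semisimple. -/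

import Mathlib

open scoped TensorProduct

universe u v w

/-- `Z²(Gal(L/k), Lˣ)`: the 2-cocycles of the Galois group with values in the multiplicative
group of `L`, i.e. the maps `α` with `α(στ, ρ) α(σ, τ) = σ(α(τ, ρ)) α(σ, τρ)`. -/
def TwoCocycle (k : Type u) (L : Type v) [Field k] [Field L] [Algebra k L] : Type v :=
  {α : Gal(L/k) × Gal(L/k) → Lˣ // groupCohomology.IsMulCocycle₂ α}

/-- The underlying space of the crossed product `(L/k, Gal(L/k), α)`: the `L`-vector space with
basis `(U_σ)`, where `f : Gal(L/k) → L` stands for `∑ σ, f σ U_σ`. The multiplication is defined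
below and is not the pointwise one. -/
def CrossedProduct {k : Type u} {L : Type v} [Field k] [Field L] [Algebra k L]
    (_α : TwoCocycle k L) : Type v :=
  Gal(L/k) → L

namespace CrossedProduct

section Basic

variable {k : Type u} {L : Type v} [Field k] [Field L] [Algebra k L] {α : TwoCocycle k L}

instance : AddCommGroup (CrossedProduct α) := inferInstanceAs (AddCommGroup (Gal(L/k) → L))

noncomputable instance : Module k (CrossedProduct α) :=
  inferInstanceAs (Module k (Gal(L/k) → L))

@[ext]
theorem ext {f g : CrossedProduct α} (h : ∀ σ : Gal(L/k), f σ = g σ) : f = g := funext h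

theorem add_apply (f g : CrossedProduct α) (σ : Gal(L/k)) : (f + g) σ = f σ + g σ := rfl

theorem zero_apply (σ : Gal(L/k)) : (0 : CrossedProduct α) σ = 0 := rfl

theorem smul_apply (c : k) (f : CrossedProduct α) (σ : Gal(L/k)) : (c • f) σ = c • f σ := rfl

/-- The cocycle condition, read in `L`. -/
theorem cocycle (α : TwoCocycle k L) (σ τ ρ : Gal(L/k)) :
    (α.1 (σ * τ, ρ) : L) * (α.1 (σ, τ) : L) = σ (α.1 (τ, ρ) : L) * (α.1 (σ, τ * ρ) : L) := by
  have h := congrArg Units.val (α.2 σ τ ρ)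
  simpa using h

theorem cocycle_one_left (α : TwoCocycle k L) (σ : Gal(L/k)) :
    (α.1 (1, σ) : L) = (α.1 (1, 1) : L) := by
  have h := cocycle α 1 1 σ
  rw [one_mul, one_mul, AlgEquiv.one_apply] at h
  exact (mul_left_cancel₀ (Units.ne_zero _) h).symm

theorem cocycle_one_right (α : TwoCocycle k L) (σ : Gal(L/k)) :
    (α.1 (σ, 1) : L) = σ (α.1 (1, 1) : L) := by
  have h := cocycle α σ 1 1
  rw [mul_one, mul_one] at h
  exact mul_right_cancel₀ (Units.ne_zero _) h

open Classical in
/-- The element `x U_σ`. -/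
noncomputable def single (α : TwoCocycle k L) (σ : Gal(L/k)) (x : L) : CrossedProduct α :=
  fun τ => if τ = σ then x else 0

/-- The unit is `α(1, 1)⁻¹ U_1`; for a normalized cocycle this is `U_1`. -/
noncomputable instance : One (CrossedProduct α) := ⟨single α 1 (α.1 (1, 1) : L)⁻¹⟩

theorem one_def : (1 : CrossedProduct α) = single α 1 (α.1 (1, 1) : L)⁻¹ := rfl

end Basic

section Ring

variable {k : Type u} {L : Type v} [Field k] [Field L] [Algebra k L] [FiniteDimensional k L]
  {α : TwoCocycle k L}

/-- The bilinear extension of `(x U_σ)(y U_τ) = x σ(y) α(σ, τ) U_{στ}`: the coefficient of `U_ρ`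
is the sum over the pairs `(σ, τ)` with `στ = ρ`. -/
noncomputable instance : Mul (CrossedProduct α) :=
  ⟨fun f g ρ => ∑ σ : Gal(L/k), f σ * σ (g (σ⁻¹ * ρ)) * (α.1 (σ, σ⁻¹ * ρ) : L)⟩

theorem mul_apply (f g : CrossedProduct α) (ρ : Gal(L/k)) :
    (f * g) ρ = ∑ σ : Gal(L/k), f σ * σ (g (σ⁻¹ * ρ)) * (α.1 (σ, σ⁻¹ * ρ) : L) := rfl

/-- The defining rule of the crossed product. -/
theorem single_mul_single (σ τ : Gal(L/k)) (x y : L) :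
    single α σ x * single α τ y = single α (σ * τ) (x * σ y * (α.1 (σ, τ) : L)) := by
  ext ρ
  rw [mul_apply, Finset.sum_eq_single σ]
  · by_cases h : ρ = σ * τ
    · subst h; simp [single]
    · have h' : ¬ σ⁻¹ * ρ = τ := fun e => h (by rw [← e]; group)
      simp [single, h, h']
  · intro b _ hb; simp [single, hb]
  · intro h; exact absurd (Finset.mem_univ _) h

protected theorem mul_assoc' (f g h : CrossedProduct α) : f * g * h = f * (g * h) := by
  ext ρ
  simp only [mul_apply, Finset.sum_mul, map_sum, Finset.mul_sum, map_mul]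
  rw [Finset.sum_comm]
  refine Finset.sum_congr rfl fun σ _ => ?_
  refine (Equiv.sum_comp (Equiv.mulLeft σ) _).symm.trans ?_
  refine Finset.sum_congr rfl fun τ _ => ?_
  have hc := cocycle α σ τ ((σ * τ)⁻¹ * ρ)
  have e1 : σ⁻¹ * (σ * τ) = τ := by group
  have e2 : τ * ((σ * τ)⁻¹ * ρ) = σ⁻¹ * ρ := by group
  have e3 : τ⁻¹ * (σ⁻¹ * ρ) = (σ * τ)⁻¹ * ρ := by group
  rw [e2] at hc
  simp only [Equiv.coe_mulLeft, e1, e3, AlgEquiv.mul_apply]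
  linear_combination (f σ * σ (g τ) * σ (τ (h ((σ * τ)⁻¹ * ρ)))) * hc

protected theorem one_mul' (f : CrossedProduct α) : 1 * f = f := by
  ext ρ
  rw [mul_apply, Finset.sum_eq_single 1]
  · have h0 : (α.1 (1, 1) : L) ≠ 0 := Units.ne_zero _
    simp only [one_def, single, if_true, inv_one, one_mul, AlgEquiv.one_apply,
      cocycle_one_left α ρ]
    field_simp
  · intro b _ hb; simp [one_def, single, hb]
  · intro h; exact absurd (Finset.mem_univ _) h

protected theorem mul_one' (f : CrossedProduct α) : f * 1 = f := by
  ext ρ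
  rw [mul_apply, Finset.sum_eq_single ρ]
  · have h0 : ρ (α.1 (1, 1) : L) ≠ 0 := by simp
    simp only [one_def, single, if_true, inv_mul_cancel, cocycle_one_right α ρ, map_inv₀]
    field_simp
  · intro b _ hb
    have h' : ¬ b⁻¹ * ρ = 1 := fun e => hb (inv_mul_eq_one.mp e)
    simp [one_def, single, h']
  · intro h; exact absurd (Finset.mem_univ _) h

noncomputable instance : Ring (CrossedProduct α) :=
  { (inferInstance : AddCommGroup (CrossedProduct α)) with
    mul := (· * ·)
    one := 1
    mul_assoc := CrossedProduct.mul_assoc'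
    one_mul := CrossedProduct.one_mul'
    mul_one := CrossedProduct.mul_one'
    left_distrib := fun f g h => by
      ext ρ
      change (f * (g + h)) ρ = (f * g) ρ + (f * h) ρ
      simp only [mul_apply, add_apply, map_add, mul_add, add_mul, Finset.sum_add_distrib]
    right_distrib := fun f g h => by
      ext ρ
      change ((f + g) * h) ρ = (f * h) ρ + (g * h) ρ
      simp only [mul_apply, add_apply, add_mul, Finset.sum_add_distrib]
    zero_mul := fun f => by
      ext ρ
      change (0 * f) ρ = 0
      simp [mul_apply, zero_apply]
    mul_zero := fun f => by
      ext ρ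
      change (f * 0) ρ = 0
      simp [mul_apply, zero_apply] }

/-- The `k`-algebra structure, with `c • ∑ σ, f σ U_σ = ∑ σ, (c f σ) U_σ`. -/
noncomputable instance : Algebra k (CrossedProduct α) :=
  Algebra.ofModule
    (fun c f g => by
      ext ρ
      simp only [mul_apply, smul_apply, Finset.smul_sum, smul_mul_assoc])
    (fun c f g => by
      ext ρ
      simp only [mul_apply, smul_apply, Finset.smul_sum, map_smul, smul_mul_assoc,
        mul_smul_comm])

end Ring

end CrossedProduct

/-!
For one cyclic algebra `(L/k, ⟨σ⟩, α)` of degree `n`, write `v = U_σ`. Then `v ^ n = b` is a nonzero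
scalar, and the algebra is generated by `L` and `v` with `v x = σ(x) v`. The Hopf algebra is built
from three ingredients.

* The commutative Hopf algebra of the functor `R ↦ {idempotents of L ⊗ R}`, with group law
  `x + y - 2xy`. This is a finite étale group scheme, a form of `(ℤ/2)ⁿ`. Its coordinate ring is
  generated by the coordinates of the universal idempotent `E ∈ L ⊗ H`; mapping `E` to the
  separability idempotent of `L ⊗ L` makes `L` a quotient.
* The functions on a finite cyclic group `M = ℤ/2n`, with idempotents `e a`. Let `β(a) = b ^ a` for
  `0 ≤ a < 2n`. Its coboundary is an `n`-th power: `β(a + c) = q(a, c) ^ n β(a) β(c)` with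
  `q(a, c) = b ^ (-2 carry(a, c))`, a normalized 2-cocycle.
* An invertible generator `u` with `u E = σ⁻¹(E) u` and `u ^ n = ∑ a, β(a) e a`, where `σ` acts on
  the factor `L` of `L ⊗ H`, and with comultiplication `Δ u = J (u ⊗ u)`,
  `J = ∑ q(a, c) e a ⊗ e c`. The identity relating `β` and `q` says that `Δ` respects the relation
  for `u ^ n`, the cocycle identity that `Δ` is coassociative. At the point `a = 1` of `M` the
  relation becomes `u ^ n = b`, which gives the map onto the cyclic algebra.

For a tensor product of cyclic algebras all generators are taken together, those of different
factors commuting (`HopfDatum`, `HopfDatum.Alg`). The algebra is given by generators and relations,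
so comultiplication, counit and antipode are obtained by exhibiting families that satisfy the
relations (`HopfDatum.Rep.tensor`, `HopfDatum.counitRep`, `HopfDatum.Rep.opposite`), and the axioms
are checked on generators. No basis is needed: the subalgebra generated by the `e a` and the
coordinates of the `E i` is commutative and unramified, because idempotents lift uniquely modulo a
square-zero ideal (`formallyUnramified_of_idempotents`); hence it is finite-dimensional and
semisimple. The `u j` are units normalizing it, with powers in it, so the whole algebra is
finite-dimensional (`finite_of_units`), and it is semisimple by Maschke's averaging argument when
the `n j` are invertible in `k` (`isSemisimpleRing_of_units`).
-/

set_option linter.unusedSectionVars false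

/-! ### Coordinates in `L ⊗ R` -/

namespace TensorCoord

variable {k : Type u} [Field k] {L : Type v} [CommRing L] [Algebra k L]
variable {R : Type*} [Ring R] [Algebra k R] {R' : Type*} [Ring R'] [Algebra k R']

/-- The index type of the chosen `k`-basis of `L`. -/
abbrev Idx (k : Type u) (L : Type v) [Field k] [CommRing L] [Algebra k L] : Type v :=
  Module.Free.ChooseBasisIndex k L

/-- The chosen `k`-basis of `L`. -/
noncomputable abbrev bs (k : Type u) (L : Type v) [Field k] [CommRing L] [Algebra k L] :
    Module.Basis (Idx k L) k L :=
  Module.Free.chooseBasis k L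

/-- The `l`-th coordinate `L ⊗ R → R` with respect to the chosen basis of `L`. -/
noncomputable def coord (l : Idx k L) : L ⊗[k] R →ₗ[k] R :=
  (TensorProduct.lid k R).toLinearMap ∘ₗ ((bs k L).coord l).rTensor R

@[simp]
theorem coord_tmul (l : Idx k L) (x : L) (r : R) :
    coord l (x ⊗ₜ[k] r) = (bs k L).repr x l • r := by
  simp [coord]

/-- The extension `id ⊗ f : L ⊗ R → L ⊗ R'` of an algebra homomorphism `f : R → R'`. -/
noncomputable def mapR (L : Type v) [CommRing L] [Algebra k L] (f : R →ₐ[k] R') :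
    L ⊗[k] R →ₐ[k] L ⊗[k] R' :=
  Algebra.TensorProduct.map (AlgHom.id k L) f

@[simp]
theorem mapR_tmul (f : R →ₐ[k] R') (x : L) (r : R) : mapR L f (x ⊗ₜ[k] r) = x ⊗ₜ[k] f r := by
  simp [mapR]

/-- The action `φ ⊗ id` on `L ⊗ R` of an automorphism `φ` of `L`. -/
noncomputable def act (R : Type*) [Ring R] [Algebra k R] (φ : L ≃ₐ[k] L) :
    L ⊗[k] R →ₐ[k] L ⊗[k] R :=
  Algebra.TensorProduct.map φ.toAlgHom (AlgHom.id k R)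

@[simp]
theorem act_tmul (φ : L ≃ₐ[k] L) (x : L) (r : R) : act R φ (x ⊗ₜ[k] r) = φ x ⊗ₜ[k] r := by
  simp [act]

open MulOpposite in
/-- The identification `L ⊗ R ≃ L ⊗ Rᵐᵒᵖ`, an anti-homomorphism since `L` is commutative. -/
noncomputable def toOp : L ⊗[k] R →ₗ[k] L ⊗[k] Rᵐᵒᵖ :=
  (opLinearEquiv k (M := R)).toLinearMap.lTensor L

@[simp]
theorem toOp_tmul (x : L) (r : R) : toOp (x ⊗ₜ[k] r) = x ⊗ₜ[k] MulOpposite.op r := by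
  simp [toOp]

theorem toOp_mul (z w : L ⊗[k] R) : toOp (z * w) = toOp w * toOp z := by
  induction z using TensorProduct.induction_on with
  | zero => simp
  | add y z hy hz => simp only [map_add, mul_add, add_mul, hy, hz]
  | tmul x r =>
    induction w using TensorProduct.induction_on with
    | zero => simp
    | add y z hy hz => simp only [map_add, mul_add, add_mul, hy, hz]
    | tmul y s => simp [mul_comm]

variable [FiniteDimensional k L]

theorem sum_coord (z : L ⊗[k] R) : ∑ l, bs k L l ⊗ₜ[k] coord l z = z := by
  induction z using TensorProduct.induction_on with
  | zero => simp
  | tmul x r =>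
    simp only [coord_tmul, ← TensorProduct.smul_tmul, ← TensorProduct.sum_tmul]
    rw [(bs k L).sum_repr]
  | add y z hy hz => simp only [map_add, TensorProduct.tmul_add, Finset.sum_add_distrib, hy, hz]

theorem coord_ext {z w : L ⊗[k] R} (h : ∀ l, coord l z = coord l w) : z = w := by
  rw [← sum_coord z, ← sum_coord w]
  simp only [h]

theorem coord_sum_tmul (x : Idx k L → R) (l : Idx k L) :
    coord l (∑ m, bs k L m ⊗ₜ[k] x m) = x l := by
  classical
  simp only [map_sum, coord_tmul, Module.Basis.repr_self, Finsupp.single_apply, ite_smul,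
    one_smul, zero_smul, Finset.sum_ite_eq', Finset.mem_univ, if_true]

theorem coord_mul (l : Idx k L) (z w : L ⊗[k] R) :
    coord l (z * w) =
      ∑ i, ∑ j, (bs k L).repr (bs k L i * bs k L j) l • (coord i z * coord j w) := by
  conv_lhs => rw [← sum_coord z, ← sum_coord w]
  simp only [Finset.sum_mul_sum, Algebra.TensorProduct.tmul_mul_tmul, map_sum, coord_tmul]

theorem coord_one_tmul_mul (l : Idx k L) (r : R) (z : L ⊗[k] R) :
    coord l ((1 ⊗ₜ[k] r) * z) = r * coord l z := by
  induction z using TensorProduct.induction_on with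
  | zero => simp
  | tmul x r => simp
  | add y z hy hz => simp only [map_add, mul_add, hy, hz]

theorem coord_mul_one_tmul (l : Idx k L) (r : R) (z : L ⊗[k] R) :
    coord l (z * (1 ⊗ₜ[k] r)) = coord l z * r := by
  induction z using TensorProduct.induction_on with
  | zero => simp
  | tmul x r => simp
  | add y z hy hz => simp only [map_add, add_mul, hy, hz]

theorem coord_mul_mem (S : Subalgebra k R) {z w : L ⊗[k] R} (hz : ∀ l, coord l z ∈ S)
    (hw : ∀ l, coord l w ∈ S) (l : Idx k L) : coord l (z * w) ∈ S := by
  rw [coord_mul]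
  exact sum_mem fun i _ => sum_mem fun j _ => S.smul_mem (S.mul_mem (hz i) (hw j)) _

theorem commute_one_tmul_iff {z : L ⊗[k] R} {r : R} :
    Commute (1 ⊗ₜ[k] r) z ↔ ∀ l, Commute r (coord l z) := by
  constructor
  · intro h l
    have := congrArg (coord l) h.eq
    rwa [coord_one_tmul_mul, coord_mul_one_tmul] at this
  · intro h
    refine coord_ext fun l => ?_
    rw [coord_one_tmul_mul, coord_mul_one_tmul]
    exact h l

theorem commute_of_coord {z w : L ⊗[k] R} (h : ∀ l m, Commute (coord l z) (coord m w)) :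
    Commute z w := by
  rw [← sum_coord z, ← sum_coord w]
  refine Commute.sum_left _ _ _ fun l _ => Commute.sum_right _ _ _ fun m _ => ?_
  change _ * _ = _ * _
  rw [Algebra.TensorProduct.tmul_mul_tmul, Algebra.TensorProduct.tmul_mul_tmul, (h l m).eq,
    mul_comm]

theorem coord_mapR (f : R →ₐ[k] R') (l : Idx k L) (z : L ⊗[k] R) :
    coord l (mapR L f z) = f (coord l z) := by
  induction z using TensorProduct.induction_on with
  | zero => simp
  | tmul x r => simp
  | add y z hy hz => simp only [map_add, hy, hz]

theorem mapR_mapR {R'' : Type*} [Ring R''] [Algebra k R''] (f : R →ₐ[k] R') (g : R' →ₐ[k] R'')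
    (z : L ⊗[k] R) : mapR L g (mapR L f z) = mapR L (g.comp f) z := by
  refine coord_ext fun l => ?_
  simp only [coord_mapR, AlgHom.comp_apply]

theorem act_mapR (φ : L ≃ₐ[k] L) (f : R →ₐ[k] R') (z : L ⊗[k] R) :
    act R' φ (mapR L f z) = mapR L f (act R φ z) := by
  induction z using TensorProduct.induction_on with
  | zero => simp
  | tmul x r => simp
  | add y z hy hz => simp only [map_add, hy, hz]

theorem act_symm_act (φ : L ≃ₐ[k] L) (z : L ⊗[k] R) : act R φ.symm (act R φ z) = z := by
  induction z using TensorProduct.induction_on with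
  | zero => simp
  | tmul x r => simp
  | add y z hy hz => simp only [map_add, hy, hz]

theorem coord_act_mem (S : Submodule k R) (φ : L ≃ₐ[k] L) {z : L ⊗[k] R}
    (hz : ∀ l, coord l z ∈ S) (l : Idx k L) : coord l (act R φ z) ∈ S := by
  rw [← sum_coord z]
  simp only [map_sum, act_tmul, coord_tmul]
  exact sum_mem fun m _ => S.smul_mem _ (hz m)

theorem coord_toOp (l : Idx k L) (z : L ⊗[k] R) :
    coord l (toOp z) = MulOpposite.op (coord l z) := by
  induction z using TensorProduct.induction_on with
  | zero => simp
  | tmul x r => simp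
  | add y z hy hz => simp only [map_add, hy, hz, MulOpposite.op_add]

theorem act_toOp (φ : L ≃ₐ[k] L) (z : L ⊗[k] R) : act Rᵐᵒᵖ φ (toOp z) = toOp (act R φ z) := by
  induction z using TensorProduct.induction_on with
  | zero => simp
  | tmul x r => simp
  | add y z hy hz => simp only [map_add, hy, hz]

end TensorCoord

/-! ### The algebra attached to a datum -/

open TensorCoord

/-- The parameters of the construction: a finite index set `I`, algebras `L i`, a finite abelian
group `M`, and for each `j : I`
* automorphisms `φ j i` of the `L i`, by which the generator `u j` acts;
* an exponent `n j`;
* a normalized 2-cocycle `q j` of `M` with values in `kˣ`, the twist in the comultiplication of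
  `u j`;
* a function `β j` on `M`, the value of `u j ^ n j`, whose coboundary is the inverse of
  `q j ^ n j`.

No compatibility between the `φ j i` is imposed: the algebra is given by generators and relations,
and it may collapse when there is none. -/
structure HopfDatum (k : Type u) [Field k] (I : Type) (L : I → Type v) [∀ i, CommRing (L i)]
    [∀ i, Algebra k (L i)] (M : Type) [AddCommGroup M] where
  φ : I → ∀ i, L i ≃ₐ[k] L i
  n : I → ℕ
  n_ne : ∀ i, n i ≠ 0
  q : I → M → M → kˣ
  β : I → M → kˣ
  q_cocycle : ∀ i a b c, q i (a + b) c * q i a b = q i a (b + c) * q i b c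
  q_zero_left : ∀ i a, q i 0 a = 1
  q_zero_right : ∀ i a, q i a 0 = 1
  β_add : ∀ i a b, β i (a + b) = q i a b ^ n i * β i a * β i b

namespace HopfDatum

variable {k : Type u} [Field k] {I : Type} {L : I → Type v} [∀ i, CommRing (L i)]
  [∀ i, Algebra k (L i)] {M : Type} [AddCommGroup M] [Fintype M] [DecidableEq M]

theorem β_zero (D : HopfDatum k I L M) (i : I) : D.β i 0 = 1 := by
  have h := D.β_add i 0 0
  rw [add_zero, D.q_zero_left, one_pow, one_mul] at h
  exact (mul_eq_left.mp h.symm)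

theorem q_neg_comm (D : HopfDatum k I L M) (i : I) (a : M) : D.q i a (-a) = D.q i (-a) a := by
  have h := D.q_cocycle i a (-a) a
  rw [add_neg_cancel, neg_add_cancel, D.q_zero_left, D.q_zero_right, one_mul, one_mul] at h
  exact h

/-- A family of elements of a `k`-algebra `R` satisfying the defining relations: complete
orthogonal central idempotents `e a`, idempotents `E i` of `L i ⊗ R` with commuting coordinates,
and commuting elements `u j` such that `u j` transforms `E i` by `φ j i` and
`u j ^ n j = ∑ a, β j a • e a`. -/
structure Rep (D : HopfDatum k I L M) (R : Type*) [Ring R] [Algebra k R] where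
  e : M → R
  E : ∀ i, L i ⊗[k] R
  u : I → R
  e_mul : ∀ a b, e a * e b = if a = b then e a else 0
  e_sum : ∑ a, e a = 1
  e_E : ∀ a i, Commute (1 ⊗ₜ[k] e a) (E i)
  e_u : ∀ a j, Commute (e a) (u j)
  E_idem : ∀ i, E i * E i = E i
  E_comm : ∀ i j l, Commute (1 ⊗ₜ[k] coord l (E i)) (E j)
  u_E : ∀ j i, (1 ⊗ₜ[k] u j) * E i = act R (D.φ j i) (E i) * (1 ⊗ₜ[k] u j)
  u_comm : ∀ i j, Commute (u i) (u j)
  u_pow : ∀ j, u j ^ D.n j = ∑ a, (D.β j a : k) • e a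

/-- The generators: the `e a`, the coordinates of the `E i`, and the `u i`. -/
inductive Gen (k : Type u) [Field k] (I : Type) (L : I → Type v) [∀ i, CommRing (L i)]
    [∀ i, Algebra k (L i)] (M : Type) : Type v
  | e : M → Gen k I L M
  | x : (i : I) → Idx k (L i) → Gen k I L M
  | u : I → Gen k I L M

section Presentation

variable [∀ i, FiniteDimensional k (L i)] (D : HopfDatum k I L M)

local notation "𝓕" => FreeAlgebra k (Gen k I L M)

/-- The generator `e a` of the free algebra. -/
noncomputable abbrev freeE (k : Type u) [Field k] (I : Type) (L : I → Type v)
    [∀ i, CommRing (L i)] [∀ i, Algebra k (L i)] {M : Type} (a : M) :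
    FreeAlgebra k (Gen k I L M) :=
  FreeAlgebra.ι k (Gen.e a)

/-- The generator `u j` of the free algebra. -/
noncomputable abbrev freeU (k : Type u) [Field k] {I : Type} (L : I → Type v)
    [∀ i, CommRing (L i)] [∀ i, Algebra k (L i)] (M : Type) (j : I) :
    FreeAlgebra k (Gen k I L M) :=
  FreeAlgebra.ι k (Gen.u j)

/-- The element of `L i ⊗ F`, for `F` the free algebra, whose coordinates are the generators
`x i l`. -/
noncomputable def freeX (k : Type u) [Field k] {I : Type} (L : I → Type v)
    [∀ i, CommRing (L i)] [∀ i, Algebra k (L i)] [∀ i, FiniteDimensional k (L i)] (M : Type)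
    (i : I) : L i ⊗[k] FreeAlgebra k (Gen k I L M) :=
  ∑ l, bs k (L i) l ⊗ₜ[k] FreeAlgebra.ι k (Gen.x i l)

/-- The relations of `Rep`, read in the coordinates of the `L i`, in the free algebra. -/
inductive Rel : 𝓕 → 𝓕 → Prop
  | e_mul (a b : M) : Rel (freeE k I L a * freeE k I L b) (if a = b then freeE k I L a else 0)
  | e_sum : Rel (∑ a : M, freeE k I L a) 1
  | e_E (a : M) (i : I) (l : Idx k (L i)) :
      Rel (freeE k I L a * coord l (freeX k L M i)) (coord l (freeX k L M i) * freeE k I L a)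
  | e_u (a : M) (j : I) : Rel (freeE k I L a * freeU k L M j) (freeU k L M j * freeE k I L a)
  | E_idem (i : I) (l : Idx k (L i)) :
      Rel (coord l (freeX k L M i * freeX k L M i)) (coord l (freeX k L M i))
  | E_comm (i : I) (l : Idx k (L i)) (j : I) (m : Idx k (L j)) :
      Rel (coord l (freeX k L M i) * coord m (freeX k L M j))
        (coord m (freeX k L M j) * coord l (freeX k L M i))
  | u_E (j i : I) (l : Idx k (L i)) :
      Rel (freeU k L M j * coord l (freeX k L M i))
        (coord l (act _ (D.φ j i) (freeX k L M i)) * freeU k L M j)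
  | u_comm (i j : I) : Rel (freeU k L M i * freeU k L M j) (freeU k L M j * freeU k L M i)
  | u_pow (j : I) :
      Rel (freeU k L M j ^ D.n j) (∑ a : M, (D.β j a : k) • freeE k I L a)

/-- The `k`-algebra with the generators `Gen` and the relations of `Rep`. -/
def Alg : Type max u v := RingQuot D.Rel

noncomputable instance : Ring D.Alg := inferInstanceAs (Ring (RingQuot D.Rel))

noncomputable instance : Algebra k D.Alg := inferInstanceAs (Algebra k (RingQuot D.Rel))

/-- The projection from the free algebra. -/
noncomputable def proj : 𝓕 →ₐ[k] D.Alg := RingQuot.mkAlgHom k D.Rel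

variable {D}

theorem proj_rel {x y : 𝓕} (h : D.Rel x y) : D.proj x = D.proj y := RingQuot.mkAlgHom_rel k h

theorem proj_surjective : Function.Surjective D.proj := RingQuot.mkAlgHom_surjective k D.Rel

variable (D) in
/-- The tautological family in `D.Alg`. -/
noncomputable def univ : D.Rep D.Alg where
  e a := D.proj (freeE k I L a)
  E i := mapR (L i) D.proj (freeX k L M i)
  u j := D.proj (freeU k L M j)
  e_mul a b := by
    rw [← map_mul, proj_rel (Rel.e_mul a b)]
    split_ifs <;> simp
  e_sum := by rw [← map_sum, proj_rel Rel.e_sum, map_one]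
  e_E a i := by
    refine commute_one_tmul_iff.mpr fun l => ?_
    rw [coord_mapR]
    change _ * _ = _ * _
    rw [← map_mul, ← map_mul, proj_rel (Rel.e_E a i l)]
  e_u a j := by
    change _ * _ = _ * _
    rw [← map_mul, ← map_mul, proj_rel (Rel.e_u a j)]
  E_idem i := by
    refine coord_ext fun l => ?_
    rw [← map_mul, coord_mapR, coord_mapR, proj_rel (Rel.E_idem i l)]
  E_comm i j l := by
    refine commute_one_tmul_iff.mpr fun m => ?_
    rw [coord_mapR, coord_mapR]
    change _ * _ = _ * _
    rw [← map_mul, ← map_mul, proj_rel (Rel.E_comm i l j m)]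
  u_E j i := by
    refine coord_ext fun l => ?_
    rw [coord_one_tmul_mul, coord_mul_one_tmul, act_mapR, coord_mapR, coord_mapR, ← map_mul,
      ← map_mul, proj_rel (Rel.u_E j i l)]
  u_comm i j := by
    change _ * _ = _ * _
    rw [← map_mul, ← map_mul, proj_rel (Rel.u_comm i j)]
  u_pow j := by
    rw [← map_pow, proj_rel (Rel.u_pow j)]
    simp only [map_sum, map_smul]

variable {R : Type*} [Ring R] [Algebra k R]

/-- The homomorphism from the free algebra given by a family. -/
noncomputable def Rep.freeLift (ρ : D.Rep R) : 𝓕 →ₐ[k] R :=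
  FreeAlgebra.lift k fun
    | .e a => ρ.e a
    | .x i l => coord l (ρ.E i)
    | .u j => ρ.u j

theorem Rep.freeLift_e (ρ : D.Rep R) (a : M) : ρ.freeLift (freeE k I L a) = ρ.e a := by
  simp [freeLift]

theorem Rep.freeLift_u (ρ : D.Rep R) (j : I) : ρ.freeLift (freeU k L M j) = ρ.u j := by
  simp [freeLift]

theorem Rep.freeLift_E (ρ : D.Rep R) (i : I) :
    mapR (L i) ρ.freeLift (freeX k L M i) = ρ.E i := by
  conv_rhs => rw [← sum_coord (ρ.E i)]
  simp [freeX, freeLift]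

theorem Rep.freeLift_rel (ρ : D.Rep R) ⦃x y : 𝓕⦄ (h : D.Rel x y) :
    ρ.freeLift x = ρ.freeLift y := by
  induction h with
  | e_mul a b =>
    rw [map_mul, freeLift_e, freeLift_e, ρ.e_mul]
    split_ifs <;> simp [freeLift_e]
  | e_sum => simp only [map_sum, freeLift_e, ρ.e_sum, map_one]
  | e_E a i l =>
    simp only [map_mul, freeLift_e, ← coord_mapR, freeLift_E]
    exact commute_one_tmul_iff.mp (ρ.e_E a i) l
  | e_u a j => simpa only [map_mul, freeLift_e, freeLift_u] using (ρ.e_u a j).eq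
  | E_idem i l => simp only [← coord_mapR, map_mul, freeLift_E, ρ.E_idem]
  | E_comm i l j m =>
    simp only [map_mul, ← coord_mapR, freeLift_E]
    exact commute_one_tmul_iff.mp (ρ.E_comm i j l) m
  | u_E j i l =>
    simp only [map_mul, ← coord_mapR, freeLift_E, freeLift_u, ← act_mapR]
    rw [← coord_one_tmul_mul, ← coord_mul_one_tmul, ρ.u_E]
  | u_comm i j => simpa only [map_mul, freeLift_u] using (ρ.u_comm i j).eq
  | u_pow j => simp only [map_pow, map_sum, map_smul, freeLift_u, freeLift_e, ρ.u_pow]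

/-- The universal property: a family in `R` is the image of the tautological one under a
homomorphism `D.Alg → R`. -/
noncomputable def Rep.lift (ρ : D.Rep R) : D.Alg →ₐ[k] R :=
  RingQuot.liftAlgHom k ⟨ρ.freeLift, ρ.freeLift_rel⟩

theorem Rep.lift_proj (ρ : D.Rep R) (x : 𝓕) : ρ.lift (D.proj x) = ρ.freeLift x :=
  RingQuot.liftAlgHom_mkAlgHom_apply k ρ.freeLift ρ.freeLift_rel x

theorem Rep.lift_comp_proj (ρ : D.Rep R) : ρ.lift.comp D.proj = ρ.freeLift :=
  AlgHom.ext ρ.lift_proj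

@[simp]
theorem Rep.lift_e (ρ : D.Rep R) (a : M) : ρ.lift (D.univ.e a) = ρ.e a :=
  (ρ.lift_proj _).trans (ρ.freeLift_e a)

@[simp]
theorem Rep.lift_u (ρ : D.Rep R) (j : I) : ρ.lift (D.univ.u j) = ρ.u j :=
  (ρ.lift_proj _).trans (ρ.freeLift_u j)

@[simp]
theorem Rep.lift_E (ρ : D.Rep R) (i : I) : mapR (L i) ρ.lift (D.univ.E i) = ρ.E i := by
  rw [← ρ.freeLift_E i, ← ρ.lift_comp_proj, ← mapR_mapR]
  rfl

/-- The generators of `D.Alg` other than the `u j`. -/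
def baseSet (D : HopfDatum k I L M) : Set D.Alg :=
  Set.range D.univ.e ∪ ⋃ i, Set.range fun l => coord l (D.univ.E i)

/-- The generators of `D.Alg`. -/
def genSet (D : HopfDatum k I L M) : Set D.Alg := D.baseSet ∪ Set.range D.univ.u

theorem adjoin_genSet : Algebra.adjoin k D.genSet = ⊤ := by
  have h : Algebra.adjoin k D.genSet = D.proj.range := by
    rw [← Algebra.map_top, ← FreeAlgebra.adjoin_range_ι, AlgHom.map_adjoin]
    congr 1
    apply Set.Subset.antisymm
    · rintro _ ((⟨a, rfl⟩ | hx) | ⟨j, rfl⟩)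
      · exact ⟨_, ⟨_, rfl⟩, rfl⟩
      · obtain ⟨i, l, rfl⟩ := Set.mem_iUnion.mp hx
        refine ⟨_, ⟨Gen.x i l, rfl⟩, ?_⟩
        simp [univ, coord_mapR, freeX, -map_sum, coord_sum_tmul]
      · exact ⟨_, ⟨_, rfl⟩, rfl⟩
    · rintro _ ⟨_, ⟨g, rfl⟩, rfl⟩
      cases g with
      | e a => exact Or.inl (Or.inl ⟨a, rfl⟩)
      | u j => exact Or.inr ⟨j, rfl⟩
      | x i l =>
        refine Or.inl (Or.inr (Set.mem_iUnion.mpr ⟨i, l, ?_⟩))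
        simp [univ, coord_mapR, freeX, -map_sum, coord_sum_tmul]
  rw [h]
  exact (AlgHom.range_eq_top _).mpr proj_surjective

/-- Homomorphisms out of `D.Alg` agree if they do on the tautological family. -/
theorem algHom_ext {f g : D.Alg →ₐ[k] R} (he : ∀ a, f (D.univ.e a) = g (D.univ.e a))
    (hE : ∀ i, mapR (L i) f (D.univ.E i) = mapR (L i) g (D.univ.E i))
    (hu : ∀ j, f (D.univ.u j) = g (D.univ.u j)) : f = g := by
  refine AlgHom.ext_of_adjoin_eq_top adjoin_genSet ?_
  rintro _ ((⟨a, rfl⟩ | hx) | ⟨j, rfl⟩)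
  · exact he a
  · obtain ⟨i, l, rfl⟩ := Set.mem_iUnion.mp hx
    change f (coord l _) = g (coord l _)
    rw [← coord_mapR, ← coord_mapR, hE]
  · exact hu j

end Presentation

end HopfDatum

/-! ### Combinations of orthogonal idempotents -/

section Comb

variable {k : Type u} [Field k] {P Q : Type*} [Fintype P] [Fintype Q] [DecidableEq P]
  [DecidableEq Q] {R S : Type*} [Ring R] [Algebra k R] [Ring S] [Algebra k S]

/-- The linear combination `∑ p, f p • e p`. -/
def comb (e : P → R) (f : P → k) : R := ∑ p, f p • e p

theorem comb_mul {e : P → R} (he : ∀ a b, e a * e b = if a = b then e a else 0) (f g : P → k) :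
    comb e f * comb e g = comb e fun p => f p * g p := by
  simp only [comb, Finset.sum_mul_sum, smul_mul_smul_comm, he, smul_ite, smul_zero,
    Finset.sum_ite_eq, Finset.mem_univ, if_true]

theorem comb_one {e : P → R} (he : ∑ a, e a = 1) : comb e (fun _ => (1 : k)) = 1 := by
  simp only [comb, one_smul, he]

theorem comb_pow {e : P → R} (he : ∀ a b, e a * e b = if a = b then e a else 0)
    (hs : ∑ a, e a = 1) (f : P → k) (n : ℕ) : comb e f ^ n = comb e fun p => f p ^ n := by
  induction n with
  | zero => simp only [pow_zero, comb_one hs]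
  | succ n ih => simp only [pow_succ, ih, comb_mul he]

theorem commute_comb {e : P → R} {r : R} (h : ∀ p, Commute (e p) r) (f : P → k) :
    Commute (comb e f) r :=
  Commute.sum_left _ _ _ fun p _ => (h p).smul_left (f p)

theorem comb_single (e : P → R) (p : P) : comb e (fun x => if x = p then (1 : k) else 0) = e p := by
  simp [comb]

/-- The products `e p ⊗ e' q` of two families. -/
noncomputable def pair (k : Type u) [Field k] [Algebra k R] [Algebra k S] (e : P → R)
    (e' : Q → S) (p : P × Q) : R ⊗[k] S :=
  e p.1 ⊗ₜ[k] e' p.2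

theorem pair_mul {e : P → R} {e' : Q → S} (he : ∀ a b, e a * e b = if a = b then e a else 0)
    (he' : ∀ a b, e' a * e' b = if a = b then e' a else 0) (a b : P × Q) :
    pair k e e' a * pair k e e' b = if a = b then pair k e e' a else 0 := by
  simp only [pair, Algebra.TensorProduct.tmul_mul_tmul, he, he', Prod.ext_iff]
  split_ifs <;> simp_all

theorem pair_sum {e : P → R} {e' : Q → S} (he : ∑ a, e a = 1) (he' : ∑ a, e' a = 1) :
    ∑ a, pair k e e' a = 1 := by
  simp only [pair, Fintype.sum_prod_type, ← TensorProduct.tmul_sum, ← TensorProduct.sum_tmul,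
    he, he']
  rfl

theorem comb_tmul_comb (e : P → R) (e' : Q → S) (f : P → k) (g : Q → k) :
    comb e f ⊗ₜ[k] comb e' g = comb (pair k e e') fun p => f p.1 * g p.2 := by
  simp only [comb, pair, Fintype.sum_prod_type, TensorProduct.sum_tmul, TensorProduct.tmul_sum,
    TensorProduct.smul_tmul_smul]
  exact Finset.sum_comm

end Comb

theorem Commute.tmul_tmul {k : Type u} [Field k] {R S : Type*} [Ring R] [Algebra k R] [Ring S]
    [Algebra k S] {a b : R} {c d : S} (h : Commute a b) (h' : Commute c d) :
    Commute (a ⊗ₜ[k] c) (b ⊗ₜ[k] d) := by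
  change _ * _ = _ * _
  rw [Algebra.TensorProduct.tmul_mul_tmul, Algebra.TensorProduct.tmul_mul_tmul, h.eq, h'.eq]

theorem commute_pair {k : Type u} [Field k] {P Q : Type*} {R S : Type*} [Ring R] [Algebra k R]
    [Ring S] [Algebra k S] {e : P → R} {e' : Q → S} {p : P × Q} {a : R} {b : S}
    (h : Commute (e p.1) a) (h' : Commute (e' p.2) b) :
    Commute (pair k e e' p) (a ⊗ₜ[k] b) :=
  Commute.tmul_tmul h h'

/-- The sum, in the group of idempotents of a commutative ring, of two idempotents; it is
associative in every ring. -/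
def idemAdd {R : Type*} [Ring R] (a b : R) : R := a + b - 2 * (a * b)

theorem map_idemAdd {R S F : Type*} [Ring R] [Ring S] [FunLike F R S] [RingHomClass F R S]
    (f : F) (a b : R) : f (idemAdd a b) = idemAdd (f a) (f b) := by
  simp only [idemAdd, two_mul, map_sub, map_add, map_mul]

theorem idemAdd_assoc {R : Type*} [Ring R] (a b c : R) :
    idemAdd (idemAdd a b) c = idemAdd a (idemAdd b c) := by
  simp only [idemAdd]
  noncomm_ring

theorem idemAdd_idem {R : Type*} [Ring R] {a b : R} (ha : a * a = a) (hb : b * b = b)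
    (h : Commute a b) : idemAdd a b * idemAdd a b = idemAdd a b := by
  have h1 : b * a = a * b := h.eq.symm
  have h2 : a * (a * b) = a * b := by rw [← mul_assoc, ha]
  have h3 : b * (a * b) = a * b := by rw [← mul_assoc, h1, mul_assoc, hb]
  have e : idemAdd a b * idemAdd a b = a * a + a * b - 2 * (a * (a * b)) + b * a + b * b
      - 2 * (b * (a * b)) - 2 * (a * (b * a)) - 2 * (a * (b * b))
      + 4 * (a * (b * (a * b))) := by
    simp only [idemAdd]
    noncomm_ring
  rw [e, h3, h1, ha, hb, h2, idemAdd]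
  noncomm_ring

namespace HopfDatum

variable {k : Type u} [Field k] {I : Type} {L : I → Type v} [∀ i, CommRing (L i)]
  [∀ i, Algebra k (L i)] {M : Type} [AddCommGroup M] [Fintype M] [DecidableEq M]
  [∀ i, FiniteDimensional k (L i)] {D : HopfDatum k I L M}
  {R S : Type*} [Ring R] [Algebra k R] [Ring S] [Algebra k S]

/-! ### The tensor product of two families -/

section Tensor

variable (ρ : D.Rep R) (ρ' : D.Rep S)

theorem Rep.e_coord (a : M) (i : I) (l : Idx k (L i)) : Commute (ρ.e a) (coord l (ρ.E i)) :=
  commute_one_tmul_iff.mp (ρ.e_E a i) l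

theorem Rep.coord_comm (i j : I) (l : Idx k (L i)) (m : Idx k (L j)) :
    Commute (coord l (ρ.E i)) (coord m (ρ.E j)) :=
  commute_one_tmul_iff.mp (ρ.E_comm i j l) m

theorem Rep.u_coord (j i : I) (l : Idx k (L i)) :
    ρ.u j * coord l (ρ.E i) = coord l (act R (D.φ j i) (ρ.E i)) * ρ.u j := by
  rw [← coord_one_tmul_mul, ← coord_mul_one_tmul, ρ.u_E]

/-- The idempotent of `L i ⊗ (R ⊗ S)` which is the sum of those coming from `R` and `S`. -/
noncomputable def Rep.tensorE (i : I) : L i ⊗[k] (R ⊗[k] S) :=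
  idemAdd (mapR (L i) (Algebra.TensorProduct.includeLeft : R →ₐ[k] R ⊗[k] S) (ρ.E i))
    (mapR (L i) (Algebra.TensorProduct.includeRight : S →ₐ[k] R ⊗[k] S) (ρ'.E i))

/-- The element `∑ a b, q(a, b) e a ⊗ e b`. -/
noncomputable def Rep.tensorJ (j : I) : R ⊗[k] S :=
  comb (pair k ρ.e ρ'.e) fun p => (D.q j p.1 p.2 : k)

theorem Rep.coord_tensorE_mem (A : Subalgebra k (R ⊗[k] S)) (i : I)
    (h : ∀ l, coord l (ρ.E i) ⊗ₜ[k] (1 : S) ∈ A) (h' : ∀ l, (1 : R) ⊗ₜ[k] coord l (ρ'.E i) ∈ A)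
    (l : Idx k (L i)) : coord l (ρ.tensorE ρ' i) ∈ A := by
  have h1 : ∀ l, coord l (mapR (L i) (Algebra.TensorProduct.includeLeft : R →ₐ[k] R ⊗[k] S)
      (ρ.E i)) ∈ A := fun l => by rw [coord_mapR]; exact h l
  have h2 : ∀ l, coord l (mapR (L i) (Algebra.TensorProduct.includeRight : S →ₐ[k] R ⊗[k] S)
      (ρ'.E i)) ∈ A := fun l => by rw [coord_mapR]; exact h' l
  rw [tensorE, idemAdd, two_mul, map_sub, map_add, map_add]
  exact A.sub_mem (A.add_mem (h1 l) (h2 l))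
    (A.add_mem (coord_mul_mem A h1 h2 l) (coord_mul_mem A h1 h2 l))

theorem Rep.commute_coord_tensorE {r : R ⊗[k] S} (i : I)
    (h : ∀ l, Commute r (coord l (ρ.E i) ⊗ₜ[k] (1 : S)))
    (h' : ∀ l, Commute r ((1 : R) ⊗ₜ[k] coord l (ρ'.E i)))
    (l : Idx k (L i)) : Commute r (coord l (ρ.tensorE ρ' i)) := by
  have := ρ.coord_tensorE_mem ρ' (Subalgebra.centralizer k {r}) i
    (fun l => by simpa [Subalgebra.mem_centralizer_iff] using (h l).eq)
    (fun l => by simpa [Subalgebra.mem_centralizer_iff] using (h' l).eq) l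
  exact (Subalgebra.mem_centralizer_iff k).mp this r rfl

theorem Rep.comb_pair_tensorE (f : M × M → k) (i : I) :
    Commute (1 ⊗ₜ[k] comb (pair k ρ.e ρ'.e) f) (ρ.tensorE ρ' i) :=
  commute_one_tmul_iff.mpr fun l => ρ.commute_coord_tensorE ρ' i
    (fun l => commute_comb (fun p => commute_pair (ρ.e_coord p.1 i l) (Commute.one_right _)) f)
    (fun l => commute_comb (fun p => commute_pair (Commute.one_right _) (ρ'.e_coord p.2 i l)) f) l

theorem Rep.comb_pair_u (f : M × M → k) (j : I) :
    Commute (comb (pair k ρ.e ρ'.e) f) (ρ.u j ⊗ₜ[k] ρ'.u j) :=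
  commute_comb (fun p => commute_pair (ρ.e_u p.1 j) (ρ'.e_u p.2 j)) f

theorem Rep.comb_pair_comm (f g : M × M → k) :
    Commute (comb (pair k ρ.e ρ'.e) f) (comb (pair k ρ.e ρ'.e) g) := by
  change _ * _ = _ * _
  simp only [comb_mul (pair_mul ρ.e_mul ρ'.e_mul), mul_comm]

theorem Rep.u_tmul_u_tensorE (j i : I) :
    (1 ⊗ₜ[k] (ρ.u j ⊗ₜ[k] ρ'.u j)) * ρ.tensorE ρ' i =
      act _ (D.φ j i) (ρ.tensorE ρ' i) * (1 ⊗ₜ[k] (ρ.u j ⊗ₜ[k] ρ'.u j)) := by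
  have h1 : (1 ⊗ₜ[k] (ρ.u j ⊗ₜ[k] ρ'.u j)) *
      mapR (L i) (Algebra.TensorProduct.includeLeft : R →ₐ[k] R ⊗[k] S) (ρ.E i) =
      act _ (D.φ j i) (mapR (L i) (Algebra.TensorProduct.includeLeft : R →ₐ[k] R ⊗[k] S)
        (ρ.E i)) * (1 ⊗ₜ[k] (ρ.u j ⊗ₜ[k] ρ'.u j)) := by
    refine coord_ext fun l => ?_
    rw [act_mapR, coord_one_tmul_mul, coord_mul_one_tmul, coord_mapR, coord_mapR]
    simp [ρ.u_coord]
  have h2 : (1 ⊗ₜ[k] (ρ.u j ⊗ₜ[k] ρ'.u j)) *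
      mapR (L i) (Algebra.TensorProduct.includeRight : S →ₐ[k] R ⊗[k] S) (ρ'.E i) =
      act _ (D.φ j i) (mapR (L i) (Algebra.TensorProduct.includeRight : S →ₐ[k] R ⊗[k] S)
        (ρ'.E i)) * (1 ⊗ₜ[k] (ρ.u j ⊗ₜ[k] ρ'.u j)) := by
    refine coord_ext fun l => ?_
    rw [act_mapR, coord_one_tmul_mul, coord_mul_one_tmul, coord_mapR, coord_mapR]
    simp [ρ'.u_coord]
  rw [tensorE, map_idemAdd, idemAdd, idemAdd]
  simp only [two_mul, mul_sub, mul_add, sub_mul, add_mul, h1, h2, ← mul_assoc]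
  simp only [mul_assoc, h2]

/-- The family in `R ⊗ S` obtained from families in `R` and `S`; the comultiplication is the case
of the tautological family, taken twice. -/
noncomputable def Rep.tensor : D.Rep (R ⊗[k] S) where
  e a := comb (pair k ρ.e ρ'.e) fun p => if p.1 + p.2 = a then (1 : k) else 0
  E i := ρ.tensorE ρ' i
  u j := ρ.tensorJ ρ' j * (ρ.u j ⊗ₜ[k] ρ'.u j)
  e_mul a b := by
    rw [comb_mul (pair_mul ρ.e_mul ρ'.e_mul)]
    split_ifs with h
    · subst h
      congr 1
      funext p
      split_ifs <;> simp
    · have : ∀ p : M × M, ((if p.1 + p.2 = a then (1 : k) else 0) *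
          if p.1 + p.2 = b then (1 : k) else 0) = 0 := by
        intro p
        split_ifs with h1 h2
        · exact absurd (h1.symm.trans h2) h
        all_goals simp
      simp [comb, this]
  e_sum := by
    simp only [comb]
    rw [Finset.sum_comm, ← pair_sum (k := k) ρ.e_sum ρ'.e_sum]
    refine Finset.sum_congr rfl fun p _ => ?_
    rw [← Finset.sum_smul]
    simp
  e_E a i := ρ.comb_pair_tensorE ρ' _ i
  e_u a j := (ρ.comb_pair_comm ρ' _ _).mul_right (ρ.comb_pair_u ρ' _ j)
  E_idem i := by
    refine idemAdd_idem ?_ ?_ ?_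
    · rw [← map_mul, ρ.E_idem]
    · rw [← map_mul, ρ'.E_idem]
    · refine commute_of_coord fun l m => ?_
      rw [coord_mapR, coord_mapR]
      exact (Commute.one_right _).tmul_tmul (Commute.one_left _)
  E_comm i j l := by
    refine commute_one_tmul_iff.mpr fun m => Commute.symm ?_
    refine ρ.commute_coord_tensorE ρ' i (fun l => Commute.symm ?_) (fun l => Commute.symm ?_) l
    · exact ρ.commute_coord_tensorE ρ' j
        (fun m => (ρ.coord_comm i j l m).tmul_tmul (Commute.one_right _))
        (fun m => (Commute.one_right _).tmul_tmul (Commute.one_left _)) m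
    · exact ρ.commute_coord_tensorE ρ' j
        (fun m => (Commute.one_left _).tmul_tmul (Commute.one_right _))
        (fun m => (Commute.one_right _).tmul_tmul (ρ'.coord_comm i j l m)) m
  u_E j i := by
    have h : (1 : L i) ⊗ₜ[k] (ρ.tensorJ ρ' j * (ρ.u j ⊗ₜ[k] ρ'.u j)) =
        (1 ⊗ₜ[k] ρ.tensorJ ρ' j) * (1 ⊗ₜ[k] (ρ.u j ⊗ₜ[k] ρ'.u j)) := by
      rw [Algebra.TensorProduct.tmul_mul_tmul, one_mul]
    have hJ := (ρ.comb_pair_tensorE ρ' (fun p => (D.q j p.1 p.2 : k)) i).map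
      (act _ (D.φ j i))
    rw [act_tmul, map_one] at hJ
    rw [h, mul_assoc, ρ.u_tmul_u_tensorE, ← mul_assoc, ← mul_assoc]
    exact congrArg (· * _) hJ.eq
  u_comm i j :=
    ((ρ.comb_pair_comm ρ' _ _).mul_right (ρ.comb_pair_u ρ' _ j)).mul_left
    ((ρ.comb_pair_u ρ' _ i).symm.mul_right
      ((ρ.u_comm i j).tmul_tmul (ρ'.u_comm i j)))
  u_pow j := by
    have h : (ρ.u j ⊗ₜ[k] ρ'.u j) ^ D.n j =
        comb (pair k ρ.e ρ'.e) fun p => (D.β j p.1 : k) * D.β j p.2 := by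
      rw [Algebra.TensorProduct.tmul_pow, ρ.u_pow, ρ'.u_pow]
      exact comb_tmul_comb ρ.e ρ'.e (fun a => (D.β j a : k)) fun a => (D.β j a : k)
    rw [tensorJ, (ρ.comb_pair_u ρ' _ j).mul_pow, h, comb_pow (pair_mul ρ.e_mul ρ'.e_mul)
      (pair_sum ρ.e_sum ρ'.e_sum), comb_mul (pair_mul ρ.e_mul ρ'.e_mul)]
    simp only [comb, Finset.smul_sum]
    rw [Finset.sum_comm]
    refine Finset.sum_congr rfl fun p _ => ?_
    simp only [smul_smul, ← Finset.sum_smul, mul_ite, mul_one, mul_zero, Finset.sum_ite_eq,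
      Finset.mem_univ, if_true, D.β_add, Units.val_mul, Units.val_pow_eq_pow_val, mul_assoc]

end Tensor

/-! ### The trivial family and the opposite family -/

/-- The family in `k` defining the counit. -/
noncomputable def counitRep (D : HopfDatum k I L M) : D.Rep k where
  e a := if a = 0 then 1 else 0
  E _ := 0
  u _ := 1
  e_mul a b := by
    by_cases h : a = b
    · subst h; simp
    · by_cases ha : a = 0
      · have hb : b ≠ 0 := fun hb => h (ha.trans hb.symm)
        simp [h, hb]
      · simp [h, ha]
  e_sum := by simp
  e_E _ _ := Commute.zero_right _
  e_u _ _ := Commute.one_right _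
  E_idem _ := mul_zero _
  E_comm _ _ _ := Commute.zero_right _
  u_E _ _ := by simp
  u_comm _ _ := Commute.one_right _
  u_pow j := by simp [D.β_zero]

/-- The inverse of `u j`. -/
noncomputable def Rep.uInv (ρ : D.Rep R) (j : I) : R :=
  ρ.u j ^ (D.n j - 1) * comb ρ.e fun a => ((D.β j a)⁻¹ : kˣ).val

section Antipode

variable (ρ : D.Rep R)

theorem Rep.comb_u (f : M → k) (j : I) : Commute (comb ρ.e f) (ρ.u j) :=
  commute_comb (fun a => ρ.e_u a j) f

theorem Rep.comb_comm (f g : M → k) : Commute (comb ρ.e f) (comb ρ.e g) := by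
  change _ * _ = _ * _
  simp only [comb_mul ρ.e_mul, mul_comm]

theorem Rep.comb_mul_comb_inv (f : M → kˣ) :
    (comb ρ.e fun a => (f a : k)) * (comb ρ.e fun a => ((f a)⁻¹ : kˣ).val) = 1 := by
  rw [comb_mul ρ.e_mul, ← comb_one (k := k) ρ.e_sum]
  simp

theorem Rep.u_mul_uInv (j : I) : ρ.u j * ρ.uInv j = 1 := by
  rw [uInv, ← mul_assoc, mul_pow_sub_one (D.n_ne j), ρ.u_pow]
  exact ρ.comb_mul_comb_inv (D.β j)

theorem Rep.uInv_mul_u (j : I) : ρ.uInv j * ρ.u j = 1 := by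
  rw [← ρ.u_mul_uInv j]
  exact (((Commute.refl (ρ.u j)).pow_right _).mul_right (ρ.comb_u _ j).symm).eq.symm

/-- `u j` as a unit. -/
noncomputable def Rep.uUnit (j : I) : Rˣ := ⟨ρ.u j, ρ.uInv j, ρ.u_mul_uInv j, ρ.uInv_mul_u j⟩

theorem Rep.comb_uInv (f : M → k) (j : I) : Commute (comb ρ.e f) (ρ.uInv j) :=
  Commute.units_inv_right (u := ρ.uUnit j) (ρ.comb_u f j)

theorem Rep.uInv_pow (j : I) :
    ρ.uInv j ^ D.n j = comb ρ.e fun a => ((D.β j a)⁻¹ : kˣ).val := by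
  have h : ρ.u j ^ D.n j * ρ.uInv j ^ D.n j = 1 := by
    rw [← Commute.mul_pow, ρ.u_mul_uInv, one_pow]
    exact (ρ.u_mul_uInv j).trans (ρ.uInv_mul_u j).symm
  have h' := (ρ.comb_comm (fun a => ((D.β j a)⁻¹ : kˣ).val) (fun a => (D.β j a : k))).eq.trans
    (ρ.comb_mul_comb_inv (D.β j))
  rw [ρ.u_pow] at h
  exact (left_inv_eq_right_inv h' h).symm

/-- The image of `u j` under the antipode. -/
noncomputable def Rep.uAnti (j : I) : R :=
  ρ.uInv j * comb ρ.e fun a => ((D.q j (-a) a)⁻¹ : kˣ).val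

theorem Rep.E_uInv (j i : I) :
    ρ.E i * (1 ⊗ₜ[k] ρ.uInv j) = (1 ⊗ₜ[k] ρ.uInv j) * act R (D.φ j i) (ρ.E i) := by
  have h1 : (1 : L i) ⊗ₜ[k] ρ.uInv j * 1 ⊗ₜ[k] ρ.u j = 1 := by
    rw [Algebra.TensorProduct.tmul_mul_tmul, ρ.uInv_mul_u, one_mul]; rfl
  have h2 : (1 : L i) ⊗ₜ[k] ρ.u j * 1 ⊗ₜ[k] ρ.uInv j = 1 := by
    rw [Algebra.TensorProduct.tmul_mul_tmul, ρ.u_mul_uInv, one_mul]; rfl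
  calc ρ.E i * (1 ⊗ₜ[k] ρ.uInv j)
      = ((1 : L i) ⊗ₜ[k] ρ.uInv j * 1 ⊗ₜ[k] ρ.u j) * (ρ.E i * (1 ⊗ₜ[k] ρ.uInv j)) := by
        rw [h1, one_mul]
    _ = (1 ⊗ₜ[k] ρ.uInv j) * ((1 ⊗ₜ[k] ρ.u j) * ρ.E i) * (1 ⊗ₜ[k] ρ.uInv j) := by
        simp only [mul_assoc]
    _ = (1 ⊗ₜ[k] ρ.uInv j) * act R (D.φ j i) (ρ.E i) *
          ((1 : L i) ⊗ₜ[k] ρ.u j * 1 ⊗ₜ[k] ρ.uInv j) := by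
        rw [ρ.u_E]; simp only [mul_assoc]
    _ = _ := by rw [h2, mul_one]

theorem Rep.E_comb (f : M → k) (i : I) : Commute (1 ⊗ₜ[k] comb ρ.e f) (ρ.E i) :=
  commute_one_tmul_iff.mpr fun l => commute_comb (fun a => ρ.e_coord a i l) f

theorem Rep.E_uAnti (j i : I) :
    ρ.E i * (1 ⊗ₜ[k] ρ.uAnti j) = (1 ⊗ₜ[k] ρ.uAnti j) * act R (D.φ j i) (ρ.E i) := by
  have h : (1 : L i) ⊗ₜ[k] ρ.uAnti j = (1 ⊗ₜ[k] ρ.uInv j) *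
      (1 ⊗ₜ[k] comb ρ.e fun a => ((D.q j (-a) a)⁻¹ : kˣ).val) := by
    rw [Algebra.TensorProduct.tmul_mul_tmul, one_mul, uAnti]
  have hc := (ρ.E_comb (fun a => ((D.q j (-a) a)⁻¹ : kˣ).val) i).map (act R (D.φ j i))
  rw [act_tmul, map_one] at hc
  rw [h, ← mul_assoc, ρ.E_uInv, mul_assoc, mul_assoc, hc.eq]

open MulOpposite in
/-- The family in the opposite algebra defining the antipode. -/
noncomputable def Rep.opposite : D.Rep Rᵐᵒᵖ where
  e a := op (ρ.e (-a))
  E i := toOp (ρ.E i)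
  u j := op (ρ.uAnti j)
  e_mul a b := by
    rw [← op_mul, ρ.e_mul]
    by_cases h : a = b
    · simp [h]
    · simp [h, Ne.symm h]
  e_sum := by
    refine (map_sum (opAddEquiv (α := R)) (fun a => ρ.e (-a)) _).symm.trans ?_
    exact congrArg op ((Equiv.sum_comp (Equiv.neg M) ρ.e).trans ρ.e_sum)
  e_E a i := by
    refine commute_one_tmul_iff.mpr fun l => ?_
    rw [coord_toOp]
    exact (ρ.e_coord (-a) i l).op
  e_u a j := by
    have h := ρ.comb_comm (fun x => if x = -a then (1 : k) else 0)
      (fun a => ((D.q j (-a) a)⁻¹ : kˣ).val)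
    have h' := ρ.comb_uInv (fun x => if x = -a then (1 : k) else 0) j
    rw [comb_single] at h h'
    exact (h'.mul_right h).op
  E_idem i := by rw [← toOp_mul, ρ.E_idem]
  E_comm i j l := by
    refine commute_one_tmul_iff.mpr fun m => ?_
    rw [coord_toOp, coord_toOp]
    exact (ρ.coord_comm i j l m).op
  u_E j i := by
    rw [act_toOp, ← toOp_tmul, ← toOp_mul, ← toOp_mul, ρ.E_uAnti]
  u_comm i j := by
    have h : Commute (ρ.uInv i) (ρ.uInv j) :=
      Commute.units_inv_left (u := ρ.uUnit i)
        (Commute.units_inv_right (u := ρ.uUnit j) (ρ.u_comm i j))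
    exact ((h.mul_right (ρ.comb_uInv _ i).symm).mul_left
      ((ρ.comb_uInv _ j).mul_right (ρ.comb_comm _ _))).op
  u_pow j := by
    have h : ρ.uAnti j ^ D.n j = comb ρ.e fun a => (D.β j (-a) : k) := by
      rw [uAnti, (ρ.comb_uInv _ j).symm.mul_pow, ρ.uInv_pow, comb_pow ρ.e_mul ρ.e_sum,
        comb_mul ρ.e_mul]
      congr 1
      funext a
      have hb := D.β_add j (-a) a
      rw [neg_add_cancel, D.β_zero] at hb
      have hb' : D.β j (-a) = (D.β j a)⁻¹ * (D.q j (-a) a)⁻¹ ^ D.n j := by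
        rw [inv_pow, ← mul_inv, eq_inv_iff_mul_eq_one, hb]
        simp only [mul_comm, mul_left_comm, mul_assoc]
      rw [hb', Units.val_mul, Units.val_pow_eq_pow_val]
    rw [← op_pow, h]
    refine (map_sum (opAddEquiv (α := R)) _ _).trans ?_
    rw [← Equiv.sum_comp (Equiv.neg M)]
    simp

end Antipode

end HopfDatum

namespace HopfDatum

variable {k : Type u} [Field k] {I : Type} {L : I → Type v} [∀ i, CommRing (L i)]
  [∀ i, Algebra k (L i)] {M : Type} [AddCommGroup M] [Fintype M] [DecidableEq M]
  [∀ i, FiniteDimensional k (L i)]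

/-! ### The bialgebra structure -/

section Bialgebra

variable (D : HopfDatum k I L M)

/-- The comultiplication. -/
noncomputable def comulHom : D.Alg →ₐ[k] D.Alg ⊗[k] D.Alg := (D.univ.tensor D.univ).lift

/-- The counit. -/
noncomputable def counitHom : D.Alg →ₐ[k] k := D.counitRep.lift

/-- The antipode, as a homomorphism to the opposite algebra. -/
noncomputable def antipodeHom : D.Alg →ₐ[k] D.Algᵐᵒᵖ := D.univ.opposite.lift

variable {D}

theorem comulHom_e (a : M) : D.comulHom (D.univ.e a) =
    comb (pair k D.univ.e D.univ.e) fun p => if p.1 + p.2 = a then (1 : k) else 0 :=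
  Rep.lift_e _ a

theorem comulHom_u (j : I) : D.comulHom (D.univ.u j) =
    D.univ.tensorJ D.univ j * (D.univ.u j ⊗ₜ[k] D.univ.u j) :=
  Rep.lift_u _ j

theorem comulHom_E (i : I) :
    mapR (L i) D.comulHom (D.univ.E i) = D.univ.tensorE D.univ i :=
  Rep.lift_E _ i

theorem counitHom_e (a : M) : D.counitHom (D.univ.e a) = if a = 0 then 1 else 0 :=
  Rep.lift_e _ a

theorem counitHom_u (j : I) : D.counitHom (D.univ.u j) = 1 := Rep.lift_u _ j

theorem counitHom_E (i : I) : mapR (L i) D.counitHom (D.univ.E i) = 0 := Rep.lift_E _ i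

/-- `Δ ⊗ id` pulls functions on `M × M` back along `(a, b, c) ↦ (a + b, c)`. -/
theorem assoc_map_comul_comb (f : M × M → k) :
    Algebra.TensorProduct.assoc k k k D.Alg D.Alg D.Alg
      (Algebra.TensorProduct.map D.comulHom (.id k D.Alg) (comb (pair k D.univ.e D.univ.e) f)) =
    comb (pair k D.univ.e (pair k D.univ.e D.univ.e)) fun p => f (p.1 + p.2.1, p.2.2) := by
  have h : ∀ p : M × M, Algebra.TensorProduct.assoc k k k D.Alg D.Alg D.Alg
      (Algebra.TensorProduct.map D.comulHom (.id k D.Alg) (pair k D.univ.e D.univ.e p)) =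
      ∑ r : M × M, if r.1 + r.2 = p.1 then
        pair k D.univ.e (pair k D.univ.e D.univ.e) (r.1, r.2, p.2) else 0 := by
    intro p
    simp only [pair, Algebra.TensorProduct.map_tmul, comulHom_e, comb, TensorProduct.sum_tmul,
      map_sum, ite_smul, one_smul, zero_smul, AlgHom.id_apply]
    refine Finset.sum_congr rfl fun r _ => ?_
    split_ifs <;> simp
  simp only [comb, map_sum, map_smul, h, Fintype.sum_prod_type, Finset.smul_sum, smul_ite,
    smul_zero]
  have h2 : ∀ g : M → M → M → D.Alg ⊗[k] (D.Alg ⊗[k] D.Alg),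
      ∑ s, ∑ c, ∑ a, ∑ b, (if a + b = s then f (s, c) • g a b c else 0) =
      ∑ a, ∑ b, ∑ c, f (a + b, c) • g a b c := by
    intro g
    rw [Finset.sum_comm]
    trans ∑ c, ∑ a, ∑ b, f (a + b, c) • g a b c
    · refine Finset.sum_congr rfl fun c _ => ?_
      rw [Finset.sum_comm]
      refine Finset.sum_congr rfl fun a _ => ?_
      rw [Finset.sum_comm]
      simp
    · rw [Finset.sum_comm]
      refine Finset.sum_congr rfl fun a _ => ?_
      rw [Finset.sum_comm]
  exact h2 fun a b c => pair k D.univ.e (pair k D.univ.e D.univ.e) (a, b, c)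

/-- `id ⊗ Δ` pulls functions on `M × M` back along `(a, b, c) ↦ (a, b + c)`. -/
theorem map_comul_comb (f : M × M → k) :
    Algebra.TensorProduct.map (.id k D.Alg) D.comulHom (comb (pair k D.univ.e D.univ.e) f) =
    comb (pair k D.univ.e (pair k D.univ.e D.univ.e)) fun p => f (p.1, p.2.1 + p.2.2) := by
  simp only [comb, map_sum, map_smul, pair, Algebra.TensorProduct.map_tmul, comulHom_e,
    TensorProduct.tmul_sum, Fintype.sum_prod_type, Finset.smul_sum, AlgHom.id_apply,
    ite_smul, one_smul, zero_smul]
  refine Finset.sum_congr rfl fun a _ => ?_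
  rw [Finset.sum_comm]
  refine Finset.sum_congr rfl fun b _ => ?_
  rw [Finset.sum_comm]
  refine Finset.sum_congr rfl fun c _ => ?_
  rw [Finset.sum_eq_single (b + c)]
  · simp
  · intro s _ hs
    simp [Ne.symm hs]
  · simp

theorem assoc_comb_tmul_one (f : M × M → k) :
    Algebra.TensorProduct.assoc k k k D.Alg D.Alg D.Alg
      (comb (pair k D.univ.e D.univ.e) f ⊗ₜ[k] (1 : D.Alg)) =
    comb (pair k D.univ.e (pair k D.univ.e D.univ.e)) fun p => f (p.1, p.2.1) := by
  rw [← comb_one (k := k) D.univ.e_sum, comb_tmul_comb]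
  simp only [comb, map_sum, map_smul, Fintype.sum_prod_type, pair, mul_one]
  rfl

theorem one_tmul_comb (f : M × M → k) :
    (1 : D.Alg) ⊗ₜ[k] comb (pair k D.univ.e D.univ.e) f =
    comb (pair k D.univ.e (pair k D.univ.e D.univ.e)) fun p => f p.2 := by
  rw [← comb_one (k := k) D.univ.e_sum, comb_tmul_comb]
  simp only [one_mul]

theorem pair_pair_mul (a b : M × M × M) :
    pair k D.univ.e (pair k D.univ.e D.univ.e) a * pair k D.univ.e (pair k D.univ.e D.univ.e) b =
      if a = b then pair k D.univ.e (pair k D.univ.e D.univ.e) a else 0 :=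
  pair_mul D.univ.e_mul (pair_mul D.univ.e_mul D.univ.e_mul) a b

theorem comul_coassoc :
    (Algebra.TensorProduct.assoc k k k D.Alg D.Alg D.Alg).toAlgHom.comp
      ((Algebra.TensorProduct.map D.comulHom (.id k D.Alg)).comp D.comulHom) =
    (Algebra.TensorProduct.map (.id k D.Alg) D.comulHom).comp D.comulHom := by
  refine algHom_ext (fun a => ?_) (fun i => ?_) fun j => ?_
  · simp only [AlgHom.comp_apply, comulHom_e]
    rw [map_comul_comb]
    refine (assoc_map_comul_comb _).trans ?_
    simp only [add_assoc]
  · rw [← mapR_mapR, ← mapR_mapR, ← mapR_mapR, comulHom_E, Rep.tensorE]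
    simp only [map_idemAdd, mapR_mapR]
    have h1 : ((Algebra.TensorProduct.map D.comulHom (.id k D.Alg)).comp
        (Algebra.TensorProduct.includeLeft : D.Alg →ₐ[k] D.Alg ⊗[k] D.Alg)) =
        Algebra.TensorProduct.includeLeft.comp D.comulHom := by
      ext x; simp
    have h2 : ((Algebra.TensorProduct.map (.id k D.Alg) D.comulHom).comp
        (Algebra.TensorProduct.includeRight : D.Alg →ₐ[k] D.Alg ⊗[k] D.Alg)) =
        Algebra.TensorProduct.includeRight.comp D.comulHom := by
      ext x; simp
    rw [h1, h2, ← AlgHom.comp_assoc _ _ D.comulHom, ← mapR_mapR D.comulHom,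
      ← mapR_mapR D.comulHom, comulHom_E, Rep.tensorE]
    simp only [map_idemAdd, mapR_mapR]
    rw [idemAdd_assoc]
    have h3 : ∀ {f g : D.Alg →ₐ[k] D.Alg ⊗[k] (D.Alg ⊗[k] D.Alg)}, (∀ x, f x = g x) →
        mapR (L i) f (D.univ.E i) = mapR (L i) g (D.univ.E i) :=
      fun h => by rw [AlgHom.ext h]
    refine congrArg₂ _ (h3 fun x => ?_) (congrArg₂ _ (h3 fun x => ?_) (h3 fun x => ?_))
    · simp [Algebra.TensorProduct.one_def]
    · simp
    · simp [Algebra.TensorProduct.one_def]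
  · have hl : Algebra.TensorProduct.assoc k k k D.Alg D.Alg D.Alg
        (Algebra.TensorProduct.map D.comulHom (.id k D.Alg) (D.comulHom (D.univ.u j))) =
        (comb (pair k D.univ.e (pair k D.univ.e D.univ.e))
          fun p => (D.q j (p.1 + p.2.1) p.2.2 : k) * D.q j p.1 p.2.1) *
        (D.univ.u j ⊗ₜ[k] (D.univ.u j ⊗ₜ[k] D.univ.u j)) := by
      have h : D.comulHom (D.univ.u j) ⊗ₜ[k] D.univ.u j =
          (D.univ.tensorJ D.univ j ⊗ₜ[k] 1) * ((D.univ.u j ⊗ₜ[k] D.univ.u j) ⊗ₜ[k] D.univ.u j) := by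
        rw [comulHom_u, Algebra.TensorProduct.tmul_mul_tmul, one_mul]
      rw [← comb_mul pair_pair_mul, ← assoc_comb_tmul_one fun p : M × M => (D.q j p.1 p.2 : k),
        ← assoc_map_comul_comb fun p : M × M => (D.q j p.1 p.2 : k)]
      conv_lhs => rw [comulHom_u]
      rw [map_mul, map_mul, Algebra.TensorProduct.map_tmul, AlgHom.id_apply, h, map_mul, mul_assoc]
      rfl
    have hr : Algebra.TensorProduct.map (.id k D.Alg) D.comulHom (D.comulHom (D.univ.u j)) =
        (comb (pair k D.univ.e (pair k D.univ.e D.univ.e))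
          fun p => (D.q j p.1 (p.2.1 + p.2.2) : k) * D.q j p.2.1 p.2.2) *
        (D.univ.u j ⊗ₜ[k] (D.univ.u j ⊗ₜ[k] D.univ.u j)) := by
      have h : D.univ.u j ⊗ₜ[k] D.comulHom (D.univ.u j) =
          ((1 : D.Alg) ⊗ₜ[k] D.univ.tensorJ D.univ j) *
            (D.univ.u j ⊗ₜ[k] (D.univ.u j ⊗ₜ[k] D.univ.u j)) := by
        rw [comulHom_u, Algebra.TensorProduct.tmul_mul_tmul, one_mul]
      rw [← comb_mul pair_pair_mul, ← one_tmul_comb fun p : M × M => (D.q j p.1 p.2 : k),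
        ← map_comul_comb fun p : M × M => (D.q j p.1 p.2 : k)]
      conv_lhs => rw [comulHom_u]
      rw [map_mul, Algebra.TensorProduct.map_tmul, AlgHom.id_apply, h, mul_assoc]
      rfl
    refine hl.trans (Eq.trans ?_ hr.symm)
    congr 2
    funext p
    exact congrArg Units.val (D.q_cocycle j p.1 p.2.1 p.2.2)

theorem map_counit_left_comb (f : M × M → k) :
    Algebra.TensorProduct.map D.counitHom (.id k D.Alg) (comb (pair k D.univ.e D.univ.e) f) =
      (1 : k) ⊗ₜ[k] comb D.univ.e fun a => f (0, a) := by
  simp only [comb, map_sum, map_smul, pair, Algebra.TensorProduct.map_tmul, counitHom_e,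
    Fintype.sum_prod_type, AlgHom.id_apply, TensorProduct.tmul_sum, TensorProduct.tmul_smul]
  rw [Finset.sum_eq_single 0]
  · simp
  · intro b _ hb
    simp [hb]
  · simp

theorem map_counit_right_comb (f : M × M → k) :
    Algebra.TensorProduct.map (.id k D.Alg) D.counitHom (comb (pair k D.univ.e D.univ.e) f) =
      (comb D.univ.e fun a => f (a, 0)) ⊗ₜ[k] (1 : k) := by
  simp only [comb, map_sum, map_smul, pair, Algebra.TensorProduct.map_tmul, counitHom_e,
    Fintype.sum_prod_type, AlgHom.id_apply, TensorProduct.sum_tmul, TensorProduct.smul_tmul']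
  refine Finset.sum_congr rfl fun a _ => ?_
  rw [Finset.sum_eq_single 0]
  · simp
  · intro b _ hb
    simp [hb]
  · simp

theorem map_mapR_counit_E {S : Type*} [Ring S] [Algebra k S] (g : k →ₐ[k] S) (i : I) :
    mapR (L i) (g.comp D.counitHom) (D.univ.E i) = 0 := by
  rw [← mapR_mapR, counitHom_E, map_zero]

theorem counit_left :
    (Algebra.TensorProduct.map D.counitHom (.id k D.Alg)).comp D.comulHom =
      (Algebra.TensorProduct.lid k D.Alg).symm := by
  refine algHom_ext (fun a => ?_) (fun i => ?_) fun j => ?_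
  · rw [AlgHom.comp_apply, comulHom_e, map_counit_left_comb]
    simp only [zero_add, comb_single]
    rfl
  · rw [← mapR_mapR, comulHom_E, Rep.tensorE, map_idemAdd, mapR_mapR, mapR_mapR]
    have h1 : (Algebra.TensorProduct.map D.counitHom (.id k D.Alg)).comp
        (Algebra.TensorProduct.includeLeft : D.Alg →ₐ[k] D.Alg ⊗[k] D.Alg) =
        Algebra.TensorProduct.includeLeft.comp D.counitHom := by
      ext x; simp
    have h2 : (Algebra.TensorProduct.map D.counitHom (.id k D.Alg)).comp
        (Algebra.TensorProduct.includeRight : D.Alg →ₐ[k] D.Alg ⊗[k] D.Alg) =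
        (Algebra.TensorProduct.lid k D.Alg).symm := by
      ext x; simp
    rw [h1, h2, map_mapR_counit_E, idemAdd]
    simp
  · rw [AlgHom.comp_apply, comulHom_u, map_mul, Rep.tensorJ, map_counit_left_comb]
    simp only [D.q_zero_left, Units.val_one, comb_one D.univ.e_sum,
      Algebra.TensorProduct.map_tmul, counitHom_u]
    simp

theorem counit_right :
    (Algebra.TensorProduct.map (.id k D.Alg) D.counitHom).comp D.comulHom =
      (Algebra.TensorProduct.rid k k D.Alg).symm := by
  refine algHom_ext (fun a => ?_) (fun i => ?_) fun j => ?_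
  · rw [AlgHom.comp_apply, comulHom_e, map_counit_right_comb]
    simp only [add_zero, comb_single]
    rfl
  · rw [← mapR_mapR, comulHom_E, Rep.tensorE, map_idemAdd, mapR_mapR, mapR_mapR]
    have h1 : (Algebra.TensorProduct.map (.id k D.Alg) D.counitHom).comp
        (Algebra.TensorProduct.includeRight : D.Alg →ₐ[k] D.Alg ⊗[k] D.Alg) =
        Algebra.TensorProduct.includeRight.comp D.counitHom := by
      ext x; simp
    have h2 : (Algebra.TensorProduct.map (.id k D.Alg) D.counitHom).comp
        (Algebra.TensorProduct.includeLeft : D.Alg →ₐ[k] D.Alg ⊗[k] D.Alg) =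
        (Algebra.TensorProduct.rid k k D.Alg).symm := by
      ext x; simp
    rw [h1, h2, map_mapR_counit_E, idemAdd]
    simp
  · rw [AlgHom.comp_apply, comulHom_u, map_mul, Rep.tensorJ, map_counit_right_comb]
    simp only [D.q_zero_right, Units.val_one, comb_one D.univ.e_sum,
      Algebra.TensorProduct.map_tmul, counitHom_u]
    simp

noncomputable instance : Bialgebra k D.Alg :=
  Bialgebra.ofAlgHom D.comulHom D.counitHom comul_coassoc counit_left counit_right

end Bialgebra

end HopfDatum

/-! ### The antipode -/

section AntipodeAxiom

variable {k : Type u} [Field k] {A : Type v} [Ring A] [Algebra k A] (S : A →ₐ[k] Aᵐᵒᵖ)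

/-- The linear map underlying an anti-endomorphism. -/
noncomputable def antiLinear : A →ₗ[k] A :=
  (MulOpposite.opLinearEquiv k).symm.toLinearMap ∘ₗ S.toLinearMap

theorem antiLinear_apply (a : A) : antiLinear S a = (S a).unop := rfl

theorem antiLinear_mul (a b : A) : antiLinear S (a * b) = antiLinear S b * antiLinear S a := by
  simp [antiLinear_apply]

/-- The map `x ⊗ y ↦ S x * y`. -/
noncomputable def antiLeft : A ⊗[k] A →ₗ[k] A := LinearMap.mul' k A ∘ₗ (antiLinear S).rTensor A

/-- The map `x ⊗ y ↦ x * S y`. -/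
noncomputable def antiRight : A ⊗[k] A →ₗ[k] A := LinearMap.mul' k A ∘ₗ (antiLinear S).lTensor A

@[simp]
theorem antiLeft_tmul (x y : A) : antiLeft S (x ⊗ₜ[k] y) = antiLinear S x * y := by
  simp [antiLeft]

@[simp]
theorem antiRight_tmul (x y : A) : antiRight S (x ⊗ₜ[k] y) = x * antiLinear S y := by
  simp [antiRight]

theorem antiLeft_mul_tmul (s : A ⊗[k] A) (x y : A) :
    antiLeft S (s * (x ⊗ₜ[k] y)) = antiLinear S x * antiLeft S s * y := by
  induction s using TensorProduct.induction_on with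
  | zero => simp
  | tmul a b => simp [antiLinear_mul, mul_assoc]
  | add s t hs ht => simp only [add_mul, mul_add, map_add, hs, ht]

theorem antiRight_tmul_mul (s : A ⊗[k] A) (x y : A) :
    antiRight S ((x ⊗ₜ[k] y) * s) = x * antiRight S s * antiLinear S y := by
  induction s using TensorProduct.induction_on with
  | zero => simp
  | tmul a b => simp [antiLinear_mul, mul_assoc]
  | add s t hs ht => simp only [add_mul, mul_add, map_add, hs, ht]

theorem antiLeft_mul_of_scalar {s : A ⊗[k] A} {c : k} (hs : antiLeft S s = algebraMap k A c)
    (t : A ⊗[k] A) : antiLeft S (s * t) = algebraMap k A c * antiLeft S t := by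
  induction t using TensorProduct.induction_on with
  | zero => simp
  | tmul a b =>
    rw [antiLeft_mul_tmul, hs, ← Algebra.commutes, mul_assoc, antiLeft_tmul]
  | add s t hs ht => simp only [mul_add, map_add, hs, ht]

theorem antiRight_mul_of_scalar {s : A ⊗[k] A} {c : k} (hs : antiRight S s = algebraMap k A c)
    (t : A ⊗[k] A) : antiRight S (t * s) = algebraMap k A c * antiRight S t := by
  induction t using TensorProduct.induction_on with
  | zero => simp
  | tmul a b =>
    rw [antiRight_tmul_mul, hs, ← Algebra.commutes, mul_assoc, antiRight_tmul]
  | add s t hs ht => simp only [mul_add, add_mul, map_add, hs, ht]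

/-- The first antipode axiom holds if it does on generators, `S` being an anti-homomorphism. -/
theorem antiLeft_comul_of_adjoin (Δ : A →ₐ[k] A ⊗[k] A) (ε : A →ₐ[k] k) {s : Set A}
    (hs : Algebra.adjoin k s = ⊤) (h : ∀ a ∈ s, antiLeft S (Δ a) = algebraMap k A (ε a)) (a : A) :
    antiLeft S (Δ a) = algebraMap k A (ε a) := by
  have ha : a ∈ Algebra.adjoin k s := hs ▸ Algebra.mem_top
  induction ha using Algebra.adjoin_induction with
  | mem x hx => exact h x hx
  | algebraMap r =>
    simp [Algebra.TensorProduct.algebraMap_apply, antiLinear_apply]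
  | add x y _ _ hx hy => simp only [map_add, hx, hy]
  | mul x y _ _ hx hy => rw [map_mul, antiLeft_mul_of_scalar S hx, hy, map_mul, map_mul]

/-- The second antipode axiom holds if it does on generators, `S` being an anti-homomorphism. -/
theorem antiRight_comul_of_adjoin (Δ : A →ₐ[k] A ⊗[k] A) (ε : A →ₐ[k] k) {s : Set A}
    (hs : Algebra.adjoin k s = ⊤) (h : ∀ a ∈ s, antiRight S (Δ a) = algebraMap k A (ε a))
    (a : A) : antiRight S (Δ a) = algebraMap k A (ε a) := by
  have ha : a ∈ Algebra.adjoin k s := hs ▸ Algebra.mem_top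
  induction ha using Algebra.adjoin_induction with
  | mem x hx => exact h x hx
  | algebraMap r =>
    simp [Algebra.TensorProduct.algebraMap_apply, antiLinear_apply]
  | add x y _ _ hx hy => simp only [map_add, hx, hy]
  | mul x y _ _ hx hy =>
    rw [map_mul, antiRight_mul_of_scalar S hy, hx, map_mul, map_mul, ← Algebra.commutes]

end AntipodeAxiom

namespace HopfDatum

variable {k : Type u} [Field k] {I : Type} {L : I → Type v} [∀ i, CommRing (L i)]
  [∀ i, Algebra k (L i)] {M : Type} [AddCommGroup M] [Fintype M] [DecidableEq M]
  [∀ i, FiniteDimensional k (L i)] {D : HopfDatum k I L M}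

theorem anti_e (a : M) : antiLinear D.antipodeHom (D.univ.e a) = D.univ.e (-a) :=
  congrArg MulOpposite.unop (Rep.lift_e D.univ.opposite a)

theorem anti_u (j : I) : antiLinear D.antipodeHom (D.univ.u j) = D.univ.uAnti j :=
  congrArg MulOpposite.unop (Rep.lift_u D.univ.opposite j)

theorem anti_coord (i : I) (l : Idx k (L i)) :
    antiLinear D.antipodeHom (coord l (D.univ.E i)) = coord l (D.univ.E i) := by
  have h := congrArg (coord l) (Rep.lift_E D.univ.opposite i)
  rw [coord_mapR] at h
  exact (congrArg MulOpposite.unop (h.trans (coord_toOp l _)) :)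

theorem comul_coord (i : I) (l : Idx k (L i)) :
    D.comulHom (coord l (D.univ.E i)) =
      coord l (D.univ.E i) ⊗ₜ[k] 1 + 1 ⊗ₜ[k] coord l (D.univ.E i) -
        2 * ∑ a, ∑ b, (bs k (L i)).repr (bs k (L i) a * bs k (L i) b) l •
          (coord a (D.univ.E i) ⊗ₜ[k] coord b (D.univ.E i)) := by
  rw [← coord_mapR, comulHom_E, Rep.tensorE, idemAdd, two_mul, two_mul, map_sub, map_add, map_add,
    coord_mul]
  simp [coord_mapR]

theorem counit_coord (i : I) (l : Idx k (L i)) : D.counitHom (coord l (D.univ.E i)) = 0 := by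
  rw [← coord_mapR, counitHom_E, map_zero]

theorem Rep.sum_coord_mul_coord {R : Type*} [Ring R] [Algebra k R] (ρ : D.Rep R) (i : I)
    (l : Idx k (L i)) :
    ∑ a, ∑ b, (bs k (L i)).repr (bs k (L i) a * bs k (L i) b) l •
      (coord a (ρ.E i) * coord b (ρ.E i)) = coord l (ρ.E i) := by
  rw [← coord_mul, ρ.E_idem]

theorem antiLeft_comb (f : M × M → k) :
    antiLeft D.antipodeHom (comb (pair k D.univ.e D.univ.e) f) =
      comb D.univ.e fun a => f (-a, a) := by
  simp only [comb, map_sum, map_smul, pair, antiLeft_tmul, anti_e, D.univ.e_mul,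
    Fintype.sum_prod_type, smul_ite, smul_zero]
  rw [Finset.sum_comm]
  refine Finset.sum_congr rfl fun a _ => ?_
  rw [Finset.sum_eq_single (-a)]
  · simp
  · intro b _ hb
    rw [if_neg]
    rintro rfl
    exact hb (neg_neg b).symm
  · simp

theorem antiRight_comb (f : M × M → k) :
    antiRight D.antipodeHom (comb (pair k D.univ.e D.univ.e) f) =
      comb D.univ.e fun a => f (a, -a) := by
  simp only [comb, map_sum, map_smul, pair, antiRight_tmul, anti_e, D.univ.e_mul,
    Fintype.sum_prod_type, smul_ite, smul_zero]
  refine Finset.sum_congr rfl fun a _ => ?_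
  rw [Finset.sum_eq_single (-a)]
  · simp
  · intro b _ hb
    rw [if_neg]
    rintro rfl
    exact hb (neg_neg b).symm
  · simp

theorem antiLeft_comul (a : D.Alg) :
    antiLeft D.antipodeHom (D.comulHom a) = algebraMap k D.Alg (D.counitHom a) := by
  refine antiLeft_comul_of_adjoin _ _ _ adjoin_genSet ?_ a
  rintro _ ((⟨a, rfl⟩ | hx) | ⟨j, rfl⟩)
  · rw [comulHom_e, antiLeft_comb, counitHom_e]
    by_cases h : a = 0
    · subst h
      simp [comb_one D.univ.e_sum]
    · simp [comb, h, Ne.symm h]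
  · obtain ⟨i, l, rfl⟩ := Set.mem_iUnion.mp hx
    change antiLeft _ (D.comulHom (coord l (D.univ.E i))) = algebraMap _ _ (D.counitHom (coord l _))
    rw [comul_coord, counit_coord, two_mul]
    simp only [map_sub, map_add, map_sum, map_smul, antiLeft_tmul, anti_coord,
      D.univ.sum_coord_mul_coord]
    simp [antiLinear_apply]
  · rw [comulHom_u, antiLeft_mul_tmul, Rep.tensorJ, antiLeft_comb, anti_u, counitHom_u, map_one,
      Rep.uAnti, mul_assoc (D.univ.uInv j),
      (D.univ.comb_comm (fun a => ((D.q j (-a) a)⁻¹ : kˣ).val) _).eq,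
      D.univ.comb_mul_comb_inv fun a => D.q j (-a) a, mul_one, D.univ.uInv_mul_u]

theorem antiRight_comul (a : D.Alg) :
    antiRight D.antipodeHom (D.comulHom a) = algebraMap k D.Alg (D.counitHom a) := by
  refine antiRight_comul_of_adjoin _ _ _ adjoin_genSet ?_ a
  rintro _ ((⟨a, rfl⟩ | hx) | ⟨j, rfl⟩)
  · rw [comulHom_e, antiRight_comb, counitHom_e]
    by_cases h : a = 0
    · subst h
      simp [comb_one D.univ.e_sum]
    · simp [comb, h, Ne.symm h]
  · obtain ⟨i, l, rfl⟩ := Set.mem_iUnion.mp hx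
    change antiRight _ (D.comulHom (coord l (D.univ.E i))) = algebraMap _ _ (D.counitHom (coord l _))
    rw [comul_coord, counit_coord, two_mul]
    simp only [map_sub, map_add, map_sum, map_smul, antiRight_tmul, anti_coord,
      D.univ.sum_coord_mul_coord]
    simp [antiLinear_apply]
  · rw [comulHom_u, Rep.tensorJ, (D.univ.comb_pair_u D.univ _ j).eq,
      antiRight_tmul_mul, antiRight_comb, anti_u, counitHom_u, map_one,
      ← (D.univ.comb_u _ j).eq, mul_assoc, Rep.uAnti, ← mul_assoc (D.univ.u j),
      D.univ.u_mul_uInv, one_mul]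
    simp only [D.q_neg_comm]
    exact D.univ.comb_mul_comb_inv fun a => D.q j (-a) a

noncomputable instance : HopfAlgebra k D.Alg where
  antipode := antiLinear D.antipodeHom
  mul_antipode_rTensor_comul := LinearMap.ext antiLeft_comul
  mul_antipode_lTensor_comul := LinearMap.ext antiRight_comul

end HopfDatum

/-! ### Crossed products with finitely many units: finiteness and Maschke's theorem -/

section Crossed

variable {k : Type u} [Field k] {R : Type v} [Ring R] [Algebra k R]

theorem conj_mem_adjoin {s : Set R} {A : Subalgebra k R} {u : Rˣ}
    (h : ∀ x ∈ s, ↑u * x * ↑u⁻¹ ∈ A) {x : R} (hx : x ∈ Algebra.adjoin k s) :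
    ↑u * x * ↑u⁻¹ ∈ A := by
  induction hx using Algebra.adjoin_induction with
  | mem x hx => exact h x hx
  | algebraMap r =>
    rw [← Algebra.commutes, mul_assoc, Units.mul_inv, mul_one]
    exact A.algebraMap_mem r
  | add x y _ _ hx hy => rw [mul_add, add_mul]; exact A.add_mem hx hy
  | mul x y _ _ hx hy =>
    have : ↑u * (x * y) * ↑u⁻¹ = (↑u * x * ↑u⁻¹) * (↑u * y * ↑u⁻¹) := by
      simp only [mul_assoc, Units.inv_mul_cancel_left]
    rw [this]
    exact A.mul_mem hx hy

/-- Adjoining to a finite-dimensional subalgebra `A` a unit which normalizes `A` and has a power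
in `A` gives a finite-dimensional algebra. -/
theorem finite_adjoin_insert_unit {A : Subalgebra k R} (hA : (Subalgebra.toSubmodule A).FG)
    {u : Rˣ} (hu : ∀ x ∈ A, ↑u * x * ↑u⁻¹ ∈ A) {n : ℕ} (hn : n ≠ 0) (hun : (u : R) ^ n ∈ A) :
    (Subalgebra.toSubmodule (Algebra.adjoin k (insert (u : R) (A : Set R)))).FG := by
  let P : Submodule k R := Submodule.span k ((fun j : ℕ => (u : R) ^ j) '' Set.Iio n)
  have hP : P.FG := Submodule.fg_span ((Set.finite_Iio n).image _)
  -- `W`, spanned by the `a * u ^ j` with `j < n`, is a left ideal of the algebra in question.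
  let W : Submodule k R := Subalgebra.toSubmodule A * P
  have hW : W.FG := hA.mul hP
  have hmem : ∀ a ∈ A, ∀ j < n, a * (u : R) ^ j ∈ W := fun a ha j hj =>
    Submodule.mul_mem_mul ha (Submodule.subset_span ⟨j, hj, rfl⟩)
  have hAW : ∀ a ∈ A, ∀ w ∈ W, a * w ∈ W := by
    intro a ha w hw
    induction hw using Submodule.mul_induction_on' with
    | mem_mul_mem x hx y hy =>
      rw [← mul_assoc]
      exact Submodule.mul_mem_mul (A.mul_mem ha hx) hy
    | add x _ y _ hx hy => rw [mul_add]; exact W.add_mem hx hy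
  have huW : ∀ w ∈ W, (u : R) * w ∈ W := by
    intro w hw
    induction hw using Submodule.mul_induction_on' with
    | add x _ y _ hx hy => rw [mul_add]; exact W.add_mem hx hy
    | mem_mul_mem x hx y hy =>
      induction hy using Submodule.span_induction with
      | zero => simp
      | add y z _ _ hy hz => rw [mul_add, mul_add]; exact W.add_mem hy hz
      | smul c y _ hy => rw [mul_smul_comm, mul_smul_comm]; exact W.smul_mem c hy
      | mem y hy =>
        obtain ⟨j, hj, rfl⟩ := hy
        have e : (u : R) * (x * (u : R) ^ j) = (↑u * x * ↑u⁻¹) * (u : R) ^ (j + 1) := by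
          simp only [mul_assoc, pow_succ', Units.inv_mul_cancel_left]
        change (u : R) * (x * (u : R) ^ j) ∈ W
        rw [e]
        rcases (Nat.succ_le_of_lt hj).lt_or_eq with h | h
        · exact hmem _ (hu x hx) _ h
        · rw [← Nat.succ_eq_add_one, h]
          have := hmem _ (A.mul_mem (hu x hx) hun) 0 (Nat.pos_of_ne_zero hn)
          rwa [pow_zero, mul_one] at this
  have key : ∀ x ∈ Algebra.adjoin k (insert (u : R) (A : Set R)), ∀ w ∈ W, x * w ∈ W := by
    intro x hx
    induction hx using Algebra.adjoin_induction with
    | mem x hx =>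
      rcases hx with rfl | hx
      · exact huW
      · exact hAW x hx
    | algebraMap r => exact hAW _ (A.algebraMap_mem r)
    | add x y _ _ hx hy => intro w hw; rw [add_mul]; exact W.add_mem (hx w hw) (hy w hw)
    | mul x y _ _ hx hy => intro w hw; rw [mul_assoc]; exact hx _ (hy w hw)
  have h1 : (1 : R) ∈ W := by
    have := hmem 1 A.one_mem 0 (Nat.pos_of_ne_zero hn)
    rwa [pow_zero, mul_one] at this
  have hle : Subalgebra.toSubmodule (Algebra.adjoin k (insert (u : R) (A : Set R))) ≤ W :=
    fun x hx => by simpa using key x hx 1 h1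
  have : Module.Finite k W := Module.Finite.iff_fg.mpr hW
  exact Submodule.FG.of_le hW hle

variable {I : Type*} [Finite I] {B : Subalgebra k R} {u : I → Rˣ} {n : I → ℕ}

/-- An algebra generated by a finite-dimensional subalgebra `B` and finitely many commuting units,
which normalize `B` and have powers in `B`, is finite-dimensional. -/
theorem finite_of_units (hB : (Subalgebra.toSubmodule B).FG)
    (hu : ∀ i, ∀ x ∈ B, ↑(u i) * x * ↑(u i)⁻¹ ∈ B) (hc : ∀ i j, Commute (u i : R) (u j))
    (hn : ∀ i, n i ≠ 0) (hun : ∀ i, (u i : R) ^ n i ∈ B)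
    (htop : Algebra.adjoin k ((B : Set R) ∪ Set.range fun i => (u i : R)) = ⊤) :
    Module.Finite k R := by
  classical
  have := Fintype.ofFinite I
  have key : ∀ S : Finset I, (Subalgebra.toSubmodule
      (Algebra.adjoin k ((B : Set R) ∪ (fun i => (u i : R)) '' S))).FG := by
    intro S
    induction S using Finset.induction_on with
    | empty => rwa [Finset.coe_empty, Set.image_empty, Set.union_empty, Algebra.adjoin_eq]
    | insert i S _ ih =>
      have h := finite_adjoin_insert_unit ih (u := u i) (n := n i) ?_ (hn i)
        (Algebra.subset_adjoin (Or.inl (hun i)))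
      · rw [Algebra.adjoin_insert_adjoin] at h
        rwa [Finset.coe_insert, Set.image_insert_eq, Set.union_insert]
      · intro x hx
        refine conj_mem_adjoin ?_ hx
        rintro y (hy | ⟨j, hj, rfl⟩)
        · exact Algebra.subset_adjoin (Or.inl (hu i y hy))
        · change (u i : R) * (u j : R) * _ ∈ _
          rw [(hc i j).eq, mul_assoc, Units.mul_inv, mul_one]
          exact Algebra.subset_adjoin (Or.inr ⟨j, hj, rfl⟩)
  have h := key Finset.univ
  rw [Finset.coe_univ, Set.image_univ, htop] at h
  exact ⟨by simpa using h⟩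

theorem conj_pow_mem {A : Subalgebra k R} {w : Rˣ} (h : ∀ x ∈ A, ↑w⁻¹ * x * ↑w ∈ A) (j : ℕ)
    {x : R} (hx : x ∈ A) : ↑(w ^ j)⁻¹ * x * ↑(w ^ j) ∈ A := by
  induction j with
  | zero => simpa using hx
  | succ j ih =>
    have : ↑(w ^ (j + 1))⁻¹ * x * ↑(w ^ (j + 1)) = ↑w⁻¹ * (↑(w ^ j)⁻¹ * x * ↑(w ^ j)) * ↑w := by
      rw [pow_succ, mul_inv_rev]
      simp only [Units.val_mul, mul_assoc]
    rw [this]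
    exact h _ ih

/-- The average of `p` under conjugation by the powers of the unit `w`. -/
noncomputable def average (w : Rˣ) (n : ℕ) (p : R →ₗ[k] R) : R →ₗ[k] R :=
  (n : k)⁻¹ • ∑ j ∈ Finset.range n,
    LinearMap.mulLeft k (↑(w ^ j) : R) ∘ₗ p ∘ₗ LinearMap.mulLeft k (↑(w ^ j)⁻¹ : R)

theorem average_apply (w : Rˣ) (n : ℕ) (p : R →ₗ[k] R) (x : R) :
    average w n p x = (n : k)⁻¹ • ∑ j ∈ Finset.range n, ↑(w ^ j) * p (↑(w ^ j)⁻¹ * x) := by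
  simp [average, LinearMap.sum_apply]

/-- The average commutes with `w` as soon as `p` commutes with `w ^ n`. -/
theorem average_commute_self {w : Rˣ} {n : ℕ} {p : R →ₗ[k] R}
    (hp : ∀ x, p (↑(w ^ n) * x) = ↑(w ^ n) * p x) (x : R) :
    average w n p (↑w * x) = ↑w * average w n p x := by
  rw [average_apply, average_apply, mul_smul_comm, Finset.mul_sum]
  congr 1
  -- The summands of the left side are those of the right side, shifted cyclically by one.
  let g : ℕ → R := fun j => ↑(w ^ j) * p (↑(w ^ j)⁻¹ * (↑w * x))
  have hg : ∀ j, g (j + 1) = ↑w * (↑(w ^ j) * p (↑(w ^ j)⁻¹ * x)) := by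
    intro j
    have e : (↑(w ^ (j + 1))⁻¹ : R) * (↑w * x) = ↑(w ^ j)⁻¹ * x := by
      rw [pow_succ', mul_inv_rev, Units.val_mul, mul_assoc, Units.inv_mul_cancel_left]
    simp only [g]
    rw [e, pow_succ', Units.val_mul, mul_assoc]
  have hgn : g n = g 0 := by
    simp only [g]
    rw [← hp, Units.mul_inv_cancel_left]
    simp
  have hs : ∑ j ∈ Finset.range n, g j = ∑ j ∈ Finset.range n, g (j + 1) := by
    have h1 := Finset.sum_range_succ g n
    rw [Finset.sum_range_succ', hgn] at h1
    exact (add_right_cancel h1).symm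
  refine hs.trans (Finset.sum_congr rfl fun j _ => hg j)

/-- Maschke's theorem: an algebra generated by a semisimple subalgebra `B` and finitely many
commuting units `u i`, which normalize `B` and have powers `u i ^ n i` in `B` with `n i`
invertible, is semisimple. -/
theorem isSemisimpleRing_of_units [IsSemisimpleRing B]
    (hu' : ∀ i, ∀ x ∈ B, ↑(u i)⁻¹ * x * ↑(u i) ∈ B) (hc : ∀ i j, Commute (u i : R) (u j))
    (hn : ∀ i, (n i : k) ≠ 0) (hun : ∀ i, (u i : R) ^ n i ∈ B)
    (htop : Algebra.adjoin k ((B : Set R) ∪ Set.range fun i => (u i : R)) = ⊤) :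
    IsSemisimpleRing R := by
  classical
  have := Fintype.ofFinite I
  suffices H : ∀ N : Submodule R R, ∃ f : R →ₗ[R] N, ∀ x : N, f x = x by
    have : ComplementedLattice (Submodule R R) :=
      ⟨fun N => let ⟨f, hf⟩ := H N; ⟨_, LinearMap.isCompl_of_proj hf⟩⟩
    exact (isSemisimpleModule_iff R R).mpr this
  intro N
  -- A projection onto `N` that commutes with `B` and with more and more of the `u i`.
  have key : ∀ S : Finset I, ∃ p : R →ₗ[k] R, (∀ x, p x ∈ N) ∧ (∀ x ∈ N, p x = x) ∧
      (∀ b ∈ B, ∀ x, p (b * x) = b * p x) ∧ ∀ i ∈ S, ∀ x, p (↑(u i) * x) = ↑(u i) * p x := by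
    intro S
    induction S using Finset.induction_on with
    | empty =>
      obtain ⟨f, hf⟩ := IsSemisimpleModule.extension_property (R := B)
        (N.restrictScalars B).subtype (Submodule.subtype_injective _) LinearMap.id
      refine ⟨((N.restrictScalars B).subtype ∘ₗ f).restrictScalars k, fun x => (f x).2,
        fun x hx => ?_, fun b hb x => ?_, by simp⟩
      · exact congrArg Subtype.val (LinearMap.congr_fun hf ⟨x, hx⟩)
      · exact ((N.restrictScalars B).subtype ∘ₗ f).map_smul ⟨b, hb⟩ x
    | insert i S _ ih =>
      obtain ⟨p, hpN, hpid, hpB, hpS⟩ := ih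
      refine ⟨average (u i) (n i) p, fun x => ?_, fun x hx => ?_, fun b hb x => ?_, ?_⟩
      · rw [average_apply, ← algebraMap_smul R]
        exact N.smul_mem _ (N.sum_mem fun j _ => N.smul_mem _ (hpN _))
      · rw [average_apply, Finset.sum_congr rfl fun j _ => by
          have hm : (↑(u i ^ j)⁻¹ : R) * x ∈ N := N.smul_mem (↑(u i ^ j)⁻¹ : R) hx
          rw [hpid _ hm, Units.mul_inv_cancel_left]]
        rw [Finset.sum_const, Finset.card_range, ← Nat.cast_smul_eq_nsmul k, smul_smul,
          inv_mul_cancel₀ (hn i), one_smul]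
      · rw [average_apply, average_apply, mul_smul_comm, Finset.mul_sum]
        congr 1
        refine Finset.sum_congr rfl fun j _ => ?_
        have e : (↑(u i ^ j)⁻¹ : R) * (b * x) =
            (↑(u i ^ j)⁻¹ * b * ↑(u i ^ j)) * (↑(u i ^ j)⁻¹ * x) := by
          simp only [mul_assoc, Units.mul_inv_cancel_left]
        rw [e, hpB _ (conj_pow_mem (hu' i) j hb)]
        simp only [mul_assoc, Units.mul_inv_cancel_left]
      · intro i' hi' x
        rcases Finset.mem_insert.mp hi' with rfl | hi'
        · refine average_commute_self (fun x => ?_) x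
          rw [Units.val_pow_eq_pow_val]
          exact hpB _ (hun i') x
        · have hcu : ∀ j, Commute (u i' : R) ↑(u i ^ j) := fun j => by
            rw [Units.val_pow_eq_pow_val]
            exact (hc i' i).pow_right j
          rw [average_apply, average_apply, mul_smul_comm, Finset.mul_sum]
          congr 1
          refine Finset.sum_congr rfl fun j _ => ?_
          rw [← mul_assoc _ (u i' : R) x, ← (hcu j).units_inv_right.eq, mul_assoc, hpS i' hi',
            ← mul_assoc, ← (hcu j).eq, mul_assoc]
  obtain ⟨p, hpN, hpid, hpB, hpu⟩ := key Finset.univ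
  have hlin : ∀ r x, p (r * x) = r * p x := by
    intro r
    have hr : r ∈ Algebra.adjoin k ((B : Set R) ∪ Set.range fun i => (u i : R)) :=
      htop ▸ Algebra.mem_top
    induction hr using Algebra.adjoin_induction with
    | mem r hr =>
      rcases hr with hr | ⟨i, rfl⟩
      · exact hpB r hr
      · exact hpu i (Finset.mem_univ i)
    | algebraMap c => exact hpB _ (B.algebraMap_mem c)
    | add r s _ _ hr hs => intro x; rw [add_mul, map_add, hr, hs, add_mul]
    | mul r s _ _ hr hs => intro x; rw [mul_assoc, hr, hs, mul_assoc]
  exact ⟨{ toFun := fun x => ⟨p x, hpN x⟩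
           map_add' := fun x y => Subtype.ext (map_add p x y)
           map_smul' := fun r x => Subtype.ext (hlin r x) },
    fun x => Subtype.ext (hpid x x.2)⟩

end Crossed

/-! ### Commutative algebras generated by idempotents are unramified -/

/-- In a commutative ring, idempotents whose difference squares to zero are equal. -/
theorem idem_eq_of_sub_sq {R : Type*} [CommRing R] {a b : R} (ha : a * a = a) (hb : b * b = b)
    (h : (a - b) * (a - b) = 0) : a = b := by
  linear_combination (a - b) * h - (a + 1 - 3 * b) * ha + (b + 1 - 3 * a) * hb

/-- A commutative algebra generated by idempotents and by the coordinates of idempotents of the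
`L i ⊗ B` is unramified, because an idempotent lifts uniquely modulo a square-zero ideal. -/
theorem formallyUnramified_of_idempotents {k : Type u} [Field k] {I : Type*} {L : I → Type v}
    [∀ i, CommRing (L i)] [∀ i, Algebra k (L i)] [∀ i, FiniteDimensional k (L i)]
    {B : Type w} [CommRing B] [Algebra k B] {M : Type*} (e : M → B) (E : ∀ i, L i ⊗[k] B)
    (he : ∀ a, e a * e a = e a) (hE : ∀ i, E i * E i = E i)
    (htop : Algebra.adjoin k (Set.range e ∪ ⋃ i, Set.range fun l => coord l (E i)) = ⊤) :
    Algebra.FormallyUnramified k B := by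
  rw [Algebra.FormallyUnramified.iff_comp_injective]
  intro C _ _ J hJ f g hfg
  have hJ' : ∀ x ∈ J, ∀ y ∈ J, x * y = 0 := fun x hx y hy => by
    have := Ideal.mul_mem_mul hx hy
    rwa [← sq, hJ, Ideal.mem_bot] at this
  have hmem : ∀ b, f b - g b ∈ J := fun b =>
    Ideal.Quotient.eq.mp (AlgHom.congr_fun hfg b)
  refine AlgHom.ext_of_adjoin_eq_top htop ?_
  rintro _ (⟨a, rfl⟩ | hx)
  · exact idem_eq_of_sub_sq (by rw [← map_mul, he]) (by rw [← map_mul, he])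
      (hJ' _ (hmem _) _ (hmem _))
  · obtain ⟨i, l, rfl⟩ := Set.mem_iUnion.mp hx
    change f (coord l (E i)) = g (coord l (E i))
    rw [← coord_mapR, ← coord_mapR]
    congr 1
    refine idem_eq_of_sub_sq (by rw [← map_mul, hE]) (by rw [← map_mul, hE])
      (coord_ext fun l => ?_)
    rw [coord_mul, map_zero]
    refine Finset.sum_eq_zero fun a _ => Finset.sum_eq_zero fun b _ => ?_
    rw [map_sub, map_sub, coord_mapR, coord_mapR, coord_mapR, coord_mapR,
      hJ' _ (hmem _) _ (hmem _), smul_zero]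

namespace HopfDatum

variable {k : Type u} [Field k] {I : Type} {L : I → Type v} [∀ i, CommRing (L i)]
  [∀ i, Algebra k (L i)] {M : Type} [AddCommGroup M] [Fintype M] [DecidableEq M]
  [∀ i, FiniteDimensional k (L i)] {D : HopfDatum k I L M}

/-! ### Finiteness and semisimplicity of `D.Alg` -/

/-- The subalgebra generated by the `e a` and the coordinates of the `E i`. -/
noncomputable def base (D : HopfDatum k I L M) : Subalgebra k D.Alg := Algebra.adjoin k D.baseSet

theorem e_mem_base (a : M) : D.univ.e a ∈ D.base := Algebra.subset_adjoin (Or.inl ⟨a, rfl⟩)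

theorem coord_mem_base (i : I) (l : Idx k (L i)) : coord l (D.univ.E i) ∈ D.base :=
  Algebra.subset_adjoin (Or.inr (Set.mem_iUnion.mpr ⟨i, l, rfl⟩))

theorem u_pow_mem_base (j : I) : D.univ.u j ^ D.n j ∈ D.base := by
  rw [D.univ.u_pow]
  exact sum_mem fun a _ => D.base.smul_mem (e_mem_base a) _

instance : IsMulCommutative D.base := by
  refine Algebra.isMulCommutative_adjoin k ?_
  have he : ∀ a b, D.univ.e a * D.univ.e b = D.univ.e b * D.univ.e a := fun a b => by
    rw [D.univ.e_mul, D.univ.e_mul]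
    by_cases h : a = b
    · simp [h]
    · simp [h, Ne.symm h]
  rintro _ (⟨a, rfl⟩ | hx) _ (⟨b, rfl⟩ | hy)
  · exact he a b
  · obtain ⟨i, l, rfl⟩ := Set.mem_iUnion.mp hy
    exact (D.univ.e_coord a i l).eq
  · obtain ⟨i, l, rfl⟩ := Set.mem_iUnion.mp hx
    exact (D.univ.e_coord b i l).eq.symm
  · obtain ⟨i, l, rfl⟩ := Set.mem_iUnion.mp hx
    obtain ⟨j, m, rfl⟩ := Set.mem_iUnion.mp hy
    exact (D.univ.coord_comm i j l m).eq

theorem conj_base (j : I) {x : D.Alg} (hx : x ∈ D.base) :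
    ↑(D.univ.uUnit j) * x * ↑(D.univ.uUnit j)⁻¹ ∈ D.base := by
  refine conj_mem_adjoin ?_ hx
  rintro _ (⟨a, rfl⟩ | hx)
  · have h : D.univ.e a * D.univ.u j = D.univ.u j * D.univ.e a := D.univ.e_u a j
    change D.univ.u j * D.univ.e a * D.univ.uInv j ∈ _
    rw [← h, mul_assoc, D.univ.u_mul_uInv, mul_one]
    exact e_mem_base a
  · obtain ⟨i, l, rfl⟩ := Set.mem_iUnion.mp hx
    change D.univ.u j * coord l (D.univ.E i) * D.univ.uInv j ∈ _
    rw [D.univ.u_coord, mul_assoc, D.univ.u_mul_uInv, mul_one]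
    exact coord_act_mem (Subalgebra.toSubmodule D.base) _ (coord_mem_base i) l

theorem conj_inv_base (j : I) {x : D.Alg} (hx : x ∈ D.base) :
    ↑(D.univ.uUnit j)⁻¹ * x * ↑(D.univ.uUnit j) ∈ D.base := by
  have := conj_mem_adjoin (A := D.base) (u := (D.univ.uUnit j)⁻¹) (s := D.baseSet) ?_ hx
  · rwa [inv_inv] at this
  rw [inv_inv]
  rintro _ (⟨a, rfl⟩ | hx)
  · have h : D.univ.e a * D.univ.u j = D.univ.u j * D.univ.e a := D.univ.e_u a j
    change D.univ.uInv j * D.univ.e a * D.univ.u j ∈ _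
    rw [mul_assoc, h, ← mul_assoc, D.univ.uInv_mul_u, one_mul]
    exact e_mem_base a
  · obtain ⟨i, l, rfl⟩ := Set.mem_iUnion.mp hx
    change D.univ.uInv j * coord l (D.univ.E i) * D.univ.u j ∈ _
    have h : D.univ.u j * coord l (act _ (D.φ j i).symm (D.univ.E i)) =
        coord l (D.univ.E i) * D.univ.u j := by
      have h1 := congrArg (act _ (D.φ j i).symm) (D.univ.u_E j i)
      rw [map_mul, map_mul, act_symm_act, act_tmul, map_one] at h1
      rw [← coord_one_tmul_mul, h1, coord_mul_one_tmul]
    rw [mul_assoc, ← h, ← mul_assoc, D.univ.uInv_mul_u, one_mul]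
    exact coord_act_mem (Subalgebra.toSubmodule D.base) _ (coord_mem_base i) l

theorem adjoin_base_units : Algebra.adjoin k
    ((D.base : Set D.Alg) ∪ Set.range fun j => (D.univ.uUnit j : D.Alg)) = ⊤ := by
  rw [eq_top_iff, ← adjoin_genSet]
  refine Algebra.adjoin_mono ?_
  exact Set.union_subset_union Algebra.subset_adjoin subset_rfl

open scoped IsMulCommutative in
/-- The subalgebra `D.base` is generated by idempotents and coordinates of idempotents, hence
unramified, hence finite and reduced. -/
instance base_unramified : Algebra.FormallyUnramified k D.base := by
  let E : ∀ i, L i ⊗[k] D.base := fun i =>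
    ∑ l, bs k (L i) l ⊗ₜ[k] (⟨coord l (D.univ.E i), coord_mem_base i l⟩ : D.base)
  have hcoord : ∀ i l, coord l (E i) = ⟨coord l (D.univ.E i), coord_mem_base i l⟩ :=
    fun i l => coord_sum_tmul _ l
  refine formallyUnramified_of_idempotents (fun a => ⟨D.univ.e a, e_mem_base a⟩) E
    (fun a => Subtype.ext (by simp [D.univ.e_mul])) (fun i => coord_ext fun l => ?_) ?_
  · refine Subtype.ext ?_
    have h1 : ∀ z, ((coord l z : D.base) : D.Alg) = coord l (mapR (L i) D.base.val z) :=
      fun z => (coord_mapR D.base.val l z).symm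
    have h2 : mapR (L i) D.base.val (E i) = D.univ.E i := by
      refine coord_ext fun l => ?_
      rw [coord_mapR, hcoord]
      rfl
    rw [h1, h1, map_mul, h2, D.univ.E_idem]
  · have himg : Subtype.val '' (Set.range (fun a => (⟨D.univ.e a, e_mem_base a⟩ : D.base)) ∪
        ⋃ i, Set.range fun l => coord l (E i)) = D.baseSet := by
      rw [Set.image_union, ← Set.range_comp, Set.image_iUnion]
      simp only [← Set.range_comp]
      simp only [Function.comp_def, hcoord]
      rfl
    rw [eq_top_iff]
    rintro ⟨x, hx⟩ -
    have hx' : x ∈ (Algebra.adjoin k (Set.range (fun a => (⟨D.univ.e a, e_mem_base a⟩ : D.base)) ∪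
        ⋃ i, Set.range fun l => coord l (E i))).map D.base.val := by
      rw [AlgHom.map_adjoin]
      change x ∈ Algebra.adjoin k (Subtype.val '' _)
      rw [himg]
      exact hx
    obtain ⟨y, hy, hyx⟩ := hx'
    have : y = ⟨x, hx⟩ := Subtype.ext hyx
    exact this ▸ hy

open scoped IsMulCommutative in
theorem base_finite [Finite I] : Module.Finite k D.base := by
  have hfin : D.baseSet.Finite :=
    (Set.finite_range _).union (Set.finite_iUnion fun _ => Set.finite_range _)
  have : Algebra.FiniteType k D.base :=
    D.base.fg_iff_finiteType.mp (Subalgebra.fg_def.mpr ⟨_, hfin, rfl⟩)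
  exact Algebra.FormallyUnramified.finite_of_free k D.base

open scoped IsMulCommutative in
theorem base_isSemisimpleRing [Finite I] : IsSemisimpleRing D.base := by
  have := base_finite (D := D)
  have : IsArtinianRing D.base := IsArtinianRing.of_finite k D.base
  have : IsReduced D.base := Algebra.FormallyUnramified.isReduced_of_field k D.base
  exact IsArtinianRing.isSemisimpleRing_of_isReduced D.base

theorem alg_finite [Finite I] : Module.Finite k D.Alg := by
  refine finite_of_units (B := D.base) (u := D.univ.uUnit) (n := D.n)
    (Module.Finite.iff_fg.mp (base_finite (D := D))) (fun j x hx => conj_base j hx)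
    D.univ.u_comm D.n_ne u_pow_mem_base adjoin_base_units

theorem alg_isSemisimpleRing [Finite I] (h : ∀ j, (D.n j : k) ≠ 0) : IsSemisimpleRing D.Alg := by
  have := base_isSemisimpleRing (D := D)
  exact isSemisimpleRing_of_units (B := D.base) (u := D.univ.uUnit) (n := D.n)
    (fun j x hx => conj_inv_base j hx) D.univ.u_comm h u_pow_mem_base adjoin_base_units

end HopfDatum

/-! ### The separability idempotent of a separable extension -/

section Separability

variable {k : Type u} [Field k] {L : Type v} [Field L] [Algebra k L] [FiniteDimensional k L]
  [Algebra.IsSeparable k L]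

instance : Algebra.FormallyUnramified k L :=
  Algebra.FormallyUnramified.of_isSeparable k L

open Algebra.FormallyUnramified (elem one_tmul_mul_elem lmul_elem)

/-- An element supported on the diagonal turns multiplication by `z` into multiplication by the
restriction of `z` to the diagonal. -/
theorem mul_eq_of_diagonal {f : L ⊗[k] L} (hf : ∀ s : L, (1 ⊗ₜ s) * f = (s ⊗ₜ 1) * f)
    (z : L ⊗[k] L) : z * f = (1 ⊗ₜ[k] Algebra.TensorProduct.lmul' k z) * f := by
  induction z using TensorProduct.induction_on with
  | zero => simp
  | add y z hy hz => rw [add_mul, map_add, TensorProduct.tmul_add, add_mul, hy, hz]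
  | tmul x y =>
    have h1 : x ⊗ₜ[k] y = (1 ⊗ₜ[k] y) * (x ⊗ₜ[k] 1) := by simp
    have h2 : (1 : L) ⊗ₜ[k] (x * y) = (1 ⊗ₜ[k] y) * (1 ⊗ₜ[k] x) := by simp [mul_comm]
    rw [Algebra.TensorProduct.lmul'_apply_tmul, h1, h2, mul_assoc, mul_assoc, hf]

theorem elem_idem : elem k L * elem k L = elem k L := by
  rw [mul_eq_of_diagonal one_tmul_mul_elem, lmul_elem]
  exact one_mul _

/-- The separability idempotent is invariant under `s ⊗ s`, by its uniqueness. -/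
theorem mapR_elem (s : L ≃ₐ[k] L) :
    mapR L s.toAlgHom (elem k L) = act L s.symm (elem k L) := by
  let F : L ⊗[k] L →ₐ[k] L ⊗[k] L := (mapR L s.toAlgHom).comp (act L s)
  have hF : ∀ x y, F (x ⊗ₜ[k] y) = s x ⊗ₜ[k] s y := fun x y => by simp [F]
  have hdiag : ∀ t : L, (1 ⊗ₜ t) * F (elem k L) = (t ⊗ₜ 1) * F (elem k L) := by
    intro t
    have h := congrArg F (one_tmul_mul_elem (R := k) (s.symm t))
    rw [map_mul, map_mul, hF, hF, s.apply_symm_apply, map_one] at h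
    exact h
  have hlmul : ∀ z, Algebra.TensorProduct.lmul' k (F z) = s (Algebra.TensorProduct.lmul' k z) := by
    intro z
    induction z using TensorProduct.induction_on with
    | zero => simp
    | add y z hy hz => simp only [map_add, hy, hz]
    | tmul x y => simp [hF]
  -- Both `e` and `F e` are separability idempotents, so `e = e * F e = F e`.
  have h1 := mul_eq_of_diagonal hdiag (elem k L)
  have h2 := mul_eq_of_diagonal one_tmul_mul_elem (F (elem k L))
  rw [lmul_elem] at h1
  rw [hlmul, lmul_elem, map_one] at h2
  have h3 : F (elem k L) = elem k L := by
    rw [mul_comm, h2] at h1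
    exact ((one_mul _).symm.trans h1.symm).trans (one_mul _)
  have h4 : mapR L s.toAlgHom (act L s (elem k L)) = elem k L := h3
  rw [← act_mapR] at h4
  conv_rhs => rw [← h4, act_symm_act]

/-- The coordinates of the separability idempotent span `L`. -/
theorem mem_of_coord_elem_mem (S : Submodule k L) (h : ∀ l, coord l (elem k L) ∈ S) (x : L) :
    x ∈ S := by
  -- The span of the coordinates is an ideal containing `1`.
  have hmul : ∀ y : L, ∀ l, y * coord l (elem k L) ∈ S := by
    intro y l
    rw [← coord_one_tmul_mul, one_tmul_mul_elem]
    rw [← sum_coord (elem k L), Finset.mul_sum, map_sum]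
    refine S.sum_mem fun m _ => ?_
    rw [Algebra.TensorProduct.tmul_mul_tmul, coord_tmul, one_mul]
    exact S.smul_mem _ (h m)
  have h1 : ∑ l, bs k L l * coord l (elem k L) = 1 := by
    rw [← lmul_elem (R := k) (S := L)]
    conv_rhs => rw [← sum_coord (elem k L)]
    simp
  rw [← mul_one x, ← h1, Finset.mul_sum]
  refine S.sum_mem fun l _ => ?_
  rw [← mul_assoc]
  exact hmul _ l

end Separability

/-! ### Generators of a cyclic crossed product -/

namespace CrossedProduct

variable {k : Type u} {L : Type v} [Field k] [Field L] [Algebra k L] [FiniteDimensional k L]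
  (α : TwoCocycle k L)

theorem single_add (σ : Gal(L/k)) (x y : L) :
    single α σ (x + y) = single α σ x + single α σ y := by
  ext τ
  rw [add_apply]
  by_cases h : τ = σ <;> simp [single, h]

theorem single_zero (σ : Gal(L/k)) : single α σ 0 = 0 := by
  ext τ
  simp [single, zero_apply]

theorem smul_single (c : k) (σ : Gal(L/k)) (x : L) : c • single α σ x = single α σ (c • x) := by
  ext τ
  rw [smul_apply]
  by_cases h : τ = σ <;> simp [single, h]

theorem single_injective (σ : Gal(L/k)) : Function.Injective (single α σ) := fun x y h => by
  have := congrFun h σ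
  simpa [single] using this

theorem sum_single (f : CrossedProduct α) : ∑ σ, single α σ (f σ) = f := by
  have h : ∀ (s : Finset Gal(L/k)) (τ : Gal(L/k)),
      (∑ σ ∈ s, single α σ (f σ)) τ = ∑ σ ∈ s, single α σ (f σ) τ := by
    classical
    intro s τ
    induction s using Finset.induction_on with
    | empty => simp [zero_apply]
    | insert a s ha ih => rw [Finset.sum_insert ha, Finset.sum_insert ha, add_apply, ih]
  ext τ
  rw [h, Finset.sum_eq_single τ]
  · simp [single]
  · intro σ _ hσ
    simp [single, Ne.symm hσ]
  · simp

/-- The embedding `x ↦ x α(1, 1)⁻¹ U_1` of `L`. -/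
noncomputable def incl : L →ₐ[k] CrossedProduct α where
  toFun x := single α 1 (x * (α.1 (1, 1) : L)⁻¹)
  map_one' := by rw [one_mul, one_def]
  map_zero' := by rw [zero_mul, single_zero]
  map_add' x y := by rw [add_mul, single_add]
  map_mul' x y := by
    rw [single_mul_single, one_mul, AlgEquiv.one_apply]
    congr 1
    have h : (α.1 (1, 1) : L) ≠ 0 := Units.ne_zero _
    field_simp
  commutes' c := by
    rw [Algebra.algebraMap_eq_smul_one (A := CrossedProduct α), one_def, smul_single,
      Algebra.smul_def]

theorem incl_mul_single (σ : Gal(L/k)) (x y : L) :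
    incl α x * single α σ y = single α σ (x * y) := by
  change single α 1 _ * _ = _
  rw [single_mul_single, one_mul, AlgEquiv.one_apply, cocycle_one_left α σ]
  congr 1
  have h : (α.1 (1, 1) : L) ≠ 0 := Units.ne_zero _
  field_simp

theorem single_mul_incl (σ : Gal(L/k)) (x y : L) :
    single α σ x * incl α y = single α σ (x * σ y) := by
  change _ * single α 1 _ = _
  rw [single_mul_single, mul_one, cocycle_one_right α σ, map_mul, map_inv₀]
  congr 1
  have h : σ (α.1 (1, 1) : L) ≠ 0 := by simp
  field_simp

theorem single_one_mul_incl (σ : Gal(L/k)) (y : L) :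
    single α σ 1 * incl α y = incl α (σ y) * single α σ 1 := by
  rw [single_mul_incl, incl_mul_single, mul_comm]

theorem single_pow (σ : Gal(L/k)) (n : ℕ) :
    ∃ x : L, x ≠ 0 ∧ single α σ 1 ^ n = single α (σ ^ n) x := by
  induction n with
  | zero => exact ⟨(α.1 (1, 1) : L)⁻¹, by simp, by rw [pow_zero, pow_zero, one_def]⟩
  | succ n ih =>
    obtain ⟨x, hx, h⟩ := ih
    exact ⟨x * (σ ^ n) 1 * (α.1 (σ ^ n, σ) : L), by simp [hx], by
      rw [pow_succ, h, single_mul_single, pow_succ]⟩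

/-- For a generator `σ` of the Galois group, of order `n`, `U_σ ^ n` is a nonzero scalar. -/
theorem exists_single_pow_card [IsGalois k L] {σ : Gal(L/k)}
    (hσ : ∀ τ, τ ∈ Subgroup.zpowers σ) :
    ∃ b : kˣ, single α σ 1 ^ Nat.card Gal(L/k) = algebraMap k (CrossedProduct α) b := by
  obtain ⟨x, hx, h⟩ := single_pow α σ (Nat.card Gal(L/k))
  rw [pow_card_eq_one'] at h
  have hz : single α 1 x = incl α (x * (α.1 (1, 1) : L)) := by
    change _ = single α 1 _
    congr 1
    have h : (α.1 (1, 1) : L) ≠ 0 := Units.ne_zero _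
    field_simp
  set z := x * (α.1 (1, 1) : L) with hzdef
  have hz0 : z ≠ 0 := by simp [hzdef, hx]
  -- `U_σ` commutes with its power `z`, so `z` is fixed by `σ`.
  have hfix : σ z = z := by
    have hc : single α σ 1 * single α σ 1 ^ Nat.card Gal(L/k) =
        single α σ 1 ^ Nat.card Gal(L/k) * single α σ 1 := (pow_mul_comm' _ _).symm
    rw [h, hz, single_one_mul_incl, incl_mul_single, incl_mul_single, mul_one, mul_one] at hc
    exact single_injective α σ hc
  have hall : ∀ τ : Gal(L/k), τ z = z := by
    intro τ
    have hle : Subgroup.zpowers σ ≤ MulAction.stabilizer Gal(L/k) z := by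
      rw [Subgroup.zpowers_le]
      exact hfix
    exact hle (hσ τ)
  obtain ⟨b, hb⟩ := (IsGalois.mem_range_algebraMap_iff_fixed z).mpr hall
  have hb0 : b ≠ 0 := by
    rintro rfl
    exact hz0 (by rw [← hb, map_zero])
  refine ⟨Units.mk0 b hb0, ?_⟩
  rw [h, hz, ← hb, AlgHom.commutes]
  rfl

/-- For a generator `σ` of the Galois group, `L` and `U_σ` generate the crossed product. -/
theorem mem_of_incl_mem {σ : Gal(L/k)} (hσ : ∀ τ, τ ∈ Subgroup.zpowers σ)
    (S : Subalgebra k (CrossedProduct α)) (h : ∀ x, incl α x ∈ S) (hv : single α σ 1 ∈ S)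
    (f : CrossedProduct α) : f ∈ S := by
  rw [← sum_single α f]
  refine sum_mem fun τ _ => ?_
  obtain ⟨m, rfl⟩ := (mem_powers_iff_mem_zpowers (x := σ)).mpr (hσ τ)
  obtain ⟨x, hx, hm⟩ := single_pow α σ m
  have : single α (σ ^ m) (f (σ ^ m)) = incl α (f (σ ^ m) * x⁻¹) * single α σ 1 ^ m := by
    rw [hm, incl_mul_single, mul_assoc, inv_mul_cancel₀ hx, mul_one]
  change single α (σ ^ m) (f (σ ^ m)) ∈ S
  rw [this]
  exact S.mul_mem (h _) (S.pow_mem hv m)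

end CrossedProduct

/-! ### Tensor products of families of algebras -/

namespace PiTensorProduct

variable {k : Type u} [Field k] {I : Type*} [Fintype I] [DecidableEq I] {A : I → Type v}
  [∀ i, Ring (A i)] [∀ i, Algebra k (A i)]

theorem commute_singleAlgHom {i j : I} (h : i ≠ j) (a : A i) (b : A j) :
    Commute (singleAlgHom (R := k) i a) (singleAlgHom (R := k) j b) :=
  Commute.tprod (Pi.mulSingle_commute h a b)

theorem mem_of_singleAlgHom_mem (S : Subalgebra k (⨂[k] i, A i))
    (h : ∀ i a, singleAlgHom (R := k) i a ∈ S) (x : ⨂[k] i, A i) : x ∈ S := by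
  have ht : ∀ a : ∀ i, A i, tprod k a ∈ S := by
    intro a
    have key : ∀ s : Finset I, tprod k (fun i => if i ∈ s then a i else 1) ∈ S := by
      intro s
      induction s using Finset.induction_on with
      | empty =>
        simp only [Finset.notMem_empty, if_false]
        exact S.one_mem
      | insert i s hi ih =>
        have : tprod k (fun j => if j ∈ insert i s then a j else 1) =
            singleAlgHom (R := k) i (a i) * tprod k (fun j => if j ∈ s then a j else 1) := by
          change _ = tprod k (Pi.mulSingle i (a i)) * _
          rw [tprod_mul_tprod]
          congr 1
          funext j
          by_cases hj : j = i
          · subst hj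
            simp [hi]
          · simp [hj]
        rw [this]
        exact S.mul_mem (h i _) ih
    simpa using key Finset.univ
  have hx : x ∈ Submodule.span k (Set.range (tprod k (s := A))) := by
    rw [span_tprod_eq_top]
    trivial
  have hle : Submodule.span k (Set.range (tprod k (s := A))) ≤ Subalgebra.toSubmodule S := by
    rw [Submodule.span_le]
    rintro _ ⟨a, rfl⟩
    exact ht a
  exact hle hx

end PiTensorProduct

namespace HopfDatum

/-! ### The carry cocycle -/

section Carry

variable (N : ℕ)

/-- The carry of the addition of representatives in `ℤ/N`. -/
def carry (a b : ZMod N) : ℕ := (a.val + b.val) / N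

theorem carry_spec [NeZero N] (a b : ZMod N) :
    N * carry N a b + (a + b).val = a.val + b.val := by
  rw [carry, ZMod.val_add, Nat.div_add_mod]

theorem carry_cocycle [NeZero N] (a b c : ZMod N) :
    carry N (a + b) c + carry N a b = carry N a (b + c) + carry N b c := by
  have h1 := carry_spec N (a + b) c
  have h2 := carry_spec N a b
  have h3 := carry_spec N a (b + c)
  have h4 := carry_spec N b c
  rw [add_assoc] at h1
  refine Nat.eq_of_mul_eq_mul_left (Nat.pos_of_ne_zero (NeZero.ne N)) ?_
  rw [mul_add, mul_add]
  omega

theorem carry_zero_left [NeZero N] (a : ZMod N) : carry N 0 a = 0 := by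
  rw [carry, ZMod.val_zero, zero_add]
  exact Nat.div_eq_of_lt a.val_lt

theorem carry_zero_right [NeZero N] (a : ZMod N) : carry N a 0 = 0 := by
  rw [carry, ZMod.val_zero, add_zero]
  exact Nat.div_eq_of_lt a.val_lt

end Carry

section Construction

variable {k : Type u} [Field k] {I : Type} {L : I → Type v} [∀ i, CommRing (L i)]
  [∀ i, Algebra k (L i)]

/-- The datum with group `∏ i, ℤ/2nᵢ` and `βᵢ(a) = bᵢ ^ aᵢ`. The modulus is `2nᵢ` and not `nᵢ`,
so that `1` has the representative `1` also if `nᵢ = 1`. -/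
def ofScalars (s : I → ∀ i, L i ≃ₐ[k] L i) (n : I → ℕ) (hn : ∀ i, n i ≠ 0) (b : I → kˣ) :
    HopfDatum k I L (∀ i, ZMod (2 * n i)) where
  φ j i := (s j i).symm
  n := n
  n_ne := hn
  q i a c := (b i)⁻¹ ^ (2 * carry (2 * n i) (a i) (c i))
  β i a := b i ^ (a i).val
  q_cocycle i a c d := by
    have : NeZero (2 * n i) := ⟨by simp [hn i]⟩
    rw [← pow_add, ← pow_add, ← mul_add, ← mul_add]
    exact congrArg (fun m => (b i)⁻¹ ^ (2 * m)) (carry_cocycle _ (a i) (c i) (d i))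
  q_zero_left i a := by
    have : NeZero (2 * n i) := ⟨by simp [hn i]⟩
    rw [Pi.zero_apply, carry_zero_left, mul_zero, pow_zero]
  q_zero_right i a := by
    have : NeZero (2 * n i) := ⟨by simp [hn i]⟩
    rw [Pi.zero_apply, carry_zero_right, mul_zero, pow_zero]
  β_add i a c := by
    have : NeZero (2 * n i) := ⟨by simp [hn i]⟩
    have h := carry_spec (2 * n i) (a i) (c i)
    rw [mul_assoc, ← pow_add, ← h, pow_add, ← mul_assoc, ← pow_mul, inv_pow,
      show 2 * carry (2 * n i) (a i) (c i) * n i = 2 * n i * carry (2 * n i) (a i) (c i) by ring,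
      inv_mul_cancel, one_mul]
    rfl

end Construction

section Representation

variable {k : Type u} [Field k] {I : Type} {L : I → Type v} [∀ i, Field (L i)]
  [∀ i, Algebra k (L i)] [∀ i, FiniteDimensional k (L i)] [∀ i, Algebra.IsSeparable k (L i)]
  {M : Type} [AddCommGroup M] [Fintype M] [DecidableEq M]
  {R : Type*} [Ring R] [Algebra k R]

open Algebra.FormallyUnramified (elem)

/-- Families at a point `m` of `M`, built from homomorphisms `J i : L i → R` with commuting images
and elements `V j` which act on these images through the automorphisms `(φ j i)⁻¹`. -/
noncomputable def pointRep (D : HopfDatum k I L M) (m : M) (J : ∀ i, L i →ₐ[k] R) (V : I → R)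
    (hJ : ∀ i j x y, Commute (J i x) (J j y))
    (hVJ : ∀ j i x, V j * J i x = J i ((D.φ j i).symm x) * V j)
    (hV : ∀ i j, Commute (V i) (V j)) (hpow : ∀ j, V j ^ D.n j = algebraMap k R (D.β j m)) :
    D.Rep R where
  e a := if a = m then 1 else 0
  E i := mapR (L i) (J i) (elem k (L i))
  u := V
  e_mul a b := by
    by_cases h : a = b
    · subst h
      by_cases ha : a = m <;> simp [ha]
    · by_cases ha : a = m
      · have hb : b ≠ m := fun hb => h (ha.trans hb.symm)
        simp [h, hb]
      · simp [h, ha]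
  e_sum := by simp
  e_E a i := commute_one_tmul_iff.mpr fun l => by
    split_ifs
    · exact Commute.one_left _
    · exact Commute.zero_left _
  e_u a j := by
    split_ifs
    · exact Commute.one_left _
    · exact Commute.zero_left _
  E_idem i := by rw [← map_mul, elem_idem]
  E_comm i j l := commute_one_tmul_iff.mpr fun m => by
    rw [coord_mapR, coord_mapR]
    exact hJ _ _ _ _
  u_E j i := by
    have h := mapR_elem (D.φ j i).symm
    rw [AlgEquiv.symm_symm] at h
    refine coord_ext fun l => ?_
    rw [act_mapR, ← h, coord_one_tmul_mul, coord_mul_one_tmul, coord_mapR, coord_mapR, coord_mapR,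
      hVJ]
    rfl
  u_comm := hV
  u_pow j := by
    rw [hpow, Algebra.algebraMap_eq_smul_one]
    simp

end Representation

end HopfDatum

open CrossedProduct PiTensorProduct in
theorem theorem1p1 {k : Type u} [Field k] {r : ℕ} (L : Fin r → Type v)
    [∀ i, Field (L i)] [∀ i, Algebra k (L i)] [∀ i, FiniteDimensional k (L i)]
    [∀ i, IsGalois k (L i)] [∀ i, IsCyclic Gal(L i/k)]
    (α : ∀ i, TwoCocycle k (L i))
    (C : Type w) [Ring C] [Algebra k C] [Algebra.IsCentral k C] [IsSimpleRing C]
    (e : C ≃ₐ[k] ⨂[k] i, CrossedProduct (α i)) :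
    ∃ (H : Type (max u v)) (_ : Ring H) (_ : HopfAlgebra k H),
      FiniteDimensional k H ∧
      ((∀ i, ((Nat.card Gal(L i/k) : ℕ) : k) ≠ 0) → IsSemisimpleRing H) ∧
      ∃ π : H →ₐ[k] C, Function.Surjective π := by
  choose σ hσ using fun i => IsCyclic.exists_generator (α := Gal(L i/k))
  choose b hb using fun i => exists_single_pow_card (α i) (hσ i)
  let n : Fin r → ℕ := fun i => Nat.card Gal(L i/k)
  have hn : ∀ i, n i ≠ 0 := fun i => Nat.card_pos.ne'
  have : ∀ i, NeZero (2 * n i) := fun i => ⟨by simp [hn i]⟩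
  let s : Fin r → ∀ i, L i ≃ₐ[k] L i := fun j i => if j = i then σ i else AlgEquiv.refl
  let D := HopfDatum.ofScalars s n hn b
  let V : Fin r → ⨂[k] i, CrossedProduct (α i) := fun j =>
    singleAlgHom (R := k) j (single (α j) (σ j) 1)
  -- The point `(1, …, 1)` of the group is the one where `β j` takes the value `b j`.
  let ρ := D.pointRep (fun _ => 1)
    (fun i => (singleAlgHom (R := k) (A := fun i => CrossedProduct (α i)) i).comp (incl (α i))) V
    (fun i j x y => by
      by_cases h : i = j
      · subst h
        exact (Commute.all x y).map (AlgHom.comp _ _)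
      · exact commute_singleAlgHom h _ _)
    (fun j i x => by
      by_cases h : j = i
      · subst h
        have hs : (D.φ j j).symm = σ j := by simp [D, HopfDatum.ofScalars, s]
        rw [hs]
        simp only [V, AlgHom.comp_apply, ← map_mul, single_one_mul_incl]
      · have hs : (D.φ j i).symm = AlgEquiv.refl := by simp [D, HopfDatum.ofScalars, s, h]
        rw [hs]
        exact commute_singleAlgHom h _ _)
    (fun i j => by
      by_cases h : i = j
      · subst h
        exact Commute.refl _
      · exact commute_singleAlgHom h _ _)
    (fun j => by
      have h1 : (1 : ZMod (2 * n j)).val = 1 := ZMod.val_one'' (by omega)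
      have h2 : D.β j (fun _ => 1) = b j := by simp [D, HopfDatum.ofScalars, h1]
      rw [h2]
      simp only [V, ← map_pow]
      exact (congrArg _ (hb j)).trans (AlgHom.commutes _ _))
  refine ⟨D.Alg, inferInstance, inferInstance, D.alg_finite, fun h => D.alg_isSemisimpleRing h,
    e.symm.toAlgHom.comp ρ.lift, e.symm.surjective.comp ?_⟩
  intro x
  refine mem_of_singleAlgHom_mem ρ.lift.range (fun i a => ?_) x
  refine mem_of_incl_mem (α i) (hσ i) (ρ.lift.range.comap
    (singleAlgHom (R := k) (A := fun i => CrossedProduct (α i)) i))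
    (fun y => ?_) ?_ a
  swap
  · exact ⟨D.univ.u i, ρ.lift_u i⟩
  refine mem_of_coord_elem_mem
    (Subalgebra.toSubmodule ((ρ.lift.range.comap
    (singleAlgHom (R := k) (A := fun i => CrossedProduct (α i)) i)).comap (incl (α i))))
    (fun l => ⟨coord l (D.univ.E i), ?_⟩) y
  change ρ.lift (coord l (D.univ.E i)) = _
  rw [← coord_mapR, ρ.lift_E]
  exact coord_mapR _ l _
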